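/- Let $\mathbb K$ be a field, $d\ge 1$, and let $v_1,\dots,v_n\in\mathbb K^d$ be vectors (repetitions are allowed) in the affine hyperplane $x_d=1$. Let $\mathcal M$ be the matroid on $[n]=\{1,\dots,n\}$ whose independent sets are the index sets of linearly independent subfamilies. For every flat $F$ of $\mathcal M$ choose an ordered basis $B_F$ of $\mathrm{span}\{v_i: i\in F\}$. For an ordered set $X=(i_1,\dots,i_m)$ of elements of $[n]$ put $\chi(X)=\det(v_{i_1},\dots,v_{i_m})$, computed in the basis $B_{\mathrm{cl}(X)}$, if $X$ is independent, and $\chi(X)=0$ otherwise; a set without a specified order is listed increasingly. The Orlik–Solomon–Terao algebra is $$\mathbb A=\mathbb K[e_1,\dots,e_n]/\big\langle e_i^2\ (i\in[n]),\ e_i\ (i\text{ a loop}),\ \partial e_C\ (C\text{ a circuit of }\mathcal M,\ |C|>1)\big\rangle,$$ where $\partial e_C=\sum_{p=1}^{m}(-1)^p\chi(C\setminus i_p)\,e_{C\setminus i_p}$ for $C=\{i_1<\dots<i_m\}$ and $e_X=\prod_{i\in X}e_i$. It is graded, with component $\mathbb A_\ell$ in degree $\ell$. For each contraction $\mathcal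 M'$ of $\mathcal M$ obtained by successively contracting non-loops, and for a non-loop $x$ of $\mathcal M'$ with function $\chi'$, the contraction $\mathcal M'/x$ has the function $\chi'_{x}(X)=\chi'(X\circ x)$ ($\circ$ denotes concatenation) and the algebra $\mathbb A(\mathcal M'/x)$ defined as above from $(\mathcal M'/x,\chi'_x)$, with generators $e_i$ for $i$ in the ground set of $\mathcal M'/x$. The residue $\mathfrak p_x:\mathbb A(\mathcal M')\to\mathbb A(\mathcal M'/x)$ is the unique linear map such that for every independent set $I$ of $\mathcal M'$ $$\mathfrak p_x(e_I)=\begin{cases} e_{I\setminus x} & \text{if } x\in I,\\[2pt] \dfrac{\chi'((I\setminus y)\circ x)}{\chi'((I\setminus y)\circ y)}\,e_{I\setminus y} & \text{if } x\notin I \text{ and some } y\in I\text{ is parallel to }x,\\[2pt] 0&\text{otherwise.}\end{cases}$$ For an ordered independent set $I^\sigma=(i_1,\dots,i_\ell)$ the iterated residue is the linear form $\mathfrak p_{I^\sigma}=\mathfrak p_{i_1}\circ\mathfrak p_{i_2}\circ\dots\circ\mathfrak p_{i_\ell}:\mathbb A_\ell\to\mathbb K$ ($\mathfrak p_{i_\ell}$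 is applied first, and the degree-$0$ component of $\mathbb A(\mathcal M/I)$ is identified with $\mathbb K$), and $\mathrm{Flag}(I^\sigma)$ is the sequence of flats $\mathrm{cl}(\{i_\ell\})\subsetneq\mathrm{cl}(\{i_\ell,i_{\ell-1}\})\subsetneq\dots\subsetneq\mathrm{cl}(\{i_\ell,\dots,i_1\})$. Let $\ell\ge 0$. Let $\mathbb I_\ell$ be a diagonal basis of $\mathbb A_\ell$, that is, a collection of independent sets $I$ of cardinality $\ell$, each with a fixed ordering $I^{\sigma_I}$, such that $|\mathbb I_\ell|\ge\dim\mathbb A_\ell$ and such that for all $I,J\in\mathbb I_\ell$ and every ordering $J^\tau$ of $J$ the equality $\mathrm{Flag}(J^\tau)=\mathrm{Flag}(I^{\sigma_I})$ implies $J=I$. Then for every $J\subseteq[n]$ with $|J|=\ell$ and $e_J\neq 0$ in $\mathbb A_\ell$, $$\sum_{I\in\mathbb I_\ell}\mathfrak p_{I^{\sigma_I}}(e_J)=1 .$$ -/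

import Mathlib

namespace OSTerao

noncomputable section

/-! ### The matroid of a family of vectors -/

/-- The matroid on `Fin n` whose independent sets are the index sets of linearly independent
subfamilies of `v`. -/
def vecMatroid {K V : Type*} [Field K] [AddCommGroup V] [Module K V] {n : ℕ} (v : Fin n → V) :
    Matroid (Fin n) :=
  (IndepMatroid.ofFinite (E := Set.univ) Set.finite_univ (fun I => LinearIndepOn K v I)
    (linearIndepOn_empty K v)
    (fun _ _ hJ hIJ => LinearIndepOn.mono hJ hIJ)
    (by
      intro I J hI hJ hlt
      by_contra! hcon
      have hle : Submodule.span K (v '' J) ≤ Submodule.span K (v '' I) := by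
        rw [Submodule.span_le]
        rintro _ ⟨e, he, rfl⟩
        by_cases heI : e ∈ I
        · exact Submodule.subset_span ⟨e, heI, rfl⟩
        · by_contra hns
          exact hcon e he heI (hI.insert hns)
      have hfin : ∀ S : Set (Fin n), LinearIndepOn K v S →
          Module.finrank K (Submodule.span K (v '' S)) = S.ncard := by
        intro S hS
        have := Fintype.ofFinite S
        have h1 := finrank_span_eq_card (R := K) (b := fun x : S => v x) hS
        have h2 : Set.range (fun x : S => v x) = v '' S := by
          ext y; simp
        rw [h2, ← Nat.card_eq_fintype_card] at h1
        exact h1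
      have : FiniteDimensional K (Submodule.span K (v '' I)) :=
        FiniteDimensional.span_of_finite K (Set.toFinite _)
      have := Submodule.finrank_mono hle
      rw [hfin I hI, hfin J hJ] at this
      omega)
    (fun _ _ => Set.subset_univ _)).matroid

/-! ### The algebra attached to a matroid and a function `χ`

The function `χ` is given on ordered sets, written as lists without repetition; on a set `X` of
indices it takes the value at `X` listed in increasing order. -/

section Chi

variable {K : Type*} [Field K] {n : ℕ}

/-- The pure monomial `e_X`, in the polynomial ring on `e_1, …, e_n`. -/
def monom (K : Type*) [Field K] {n : ℕ} (X : Finset (Fin n)) : MvPolynomial (Fin n) K :=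
  ∏ i ∈ X, MvPolynomial.X i

/-- The `χ`-boundary `∂ e_X = ∑_p (-1)^p χ(X \ i_p) e_{X \ i_p}`, where
`X = {i_1 < ⋯ < i_m}`; the position `p` of `i` in `X` is the number of `j ∈ X` with `j ≤ i`. -/
def boundary (χ : List (Fin n) → K) (X : Finset (Fin n)) : MvPolynomial (Fin n) K :=
  ∑ i ∈ X, ((-1 : K) ^ (X.filter (fun j => j ≤ i)).card * χ (X.erase i).sort) •
    monom K (X.erase i)

/-- The generators of the defining ideal: the squares, the generators `e_i` for `i` outside of the
ground set (so that the algebra is generated by the `e_i` with `i` in the ground set of `M`), the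
loops, and the boundaries of the circuits with at least two elements. -/
def relations (M : Matroid (Fin n)) (χ : List (Fin n) → K) : Set (MvPolynomial (Fin n) K) :=
  {f | ∃ i, f = MvPolynomial.X i ^ 2} ∪
  {f | ∃ i, i ∉ M.E ∧ f = MvPolynomial.X i} ∪
  {f | ∃ i, M.IsLoop i ∧ f = MvPolynomial.X i} ∪
  {f | ∃ C : Finset (Fin n), M.IsCircuit (C : Set (Fin n)) ∧ 1 < C.card ∧ f = boundary χ C}

/-- The commutative `χ`-algebra of the matroid `M`. -/
abbrev Alg (M : Matroid (Fin n)) (χ : List (Fin n) → K) : Type _ :=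
  MvPolynomial (Fin n) K ⧸ Ideal.span (relations M χ)

/-- The class `[X] = e_X` in the `χ`-algebra. -/
def cls (M : Matroid (Fin n)) (χ : List (Fin n) → K) (X : Finset (Fin n)) : Alg M χ :=
  Ideal.Quotient.mk _ (monom K X)

/-- The homogeneous component of degree `ℓ` of the `χ`-algebra. -/
def piece (M : Matroid (Fin n)) (χ : List (Fin n) → K) (ℓ : ℕ) : Submodule K (Alg M χ) :=
  (MvPolynomial.homogeneousSubmodule (Fin n) K ℓ).map
    (Ideal.Quotient.mkₐ K (Ideal.span (relations M χ))).toLinearMap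

/-- The projection of the `χ`-algebra onto its component of degree `0`, identified with `K`. -/
def degZero (M : Matroid (Fin n)) (χ : List (Fin n) → K) : Alg M χ →ₐ[K] K :=
  Ideal.Quotient.liftₐ (Ideal.span (relations M χ))
    (MvPolynomial.aeval (fun _ => (0 : K))) (by
      intro a ha
      suffices h : Ideal.span (relations M χ) ≤
          RingHom.ker (MvPolynomial.aeval (R := K) (fun _ : Fin n => (0 : K))) from h ha
      rw [Ideal.span_le]
      rintro f (((⟨i, rfl⟩ | ⟨i, -, rfl⟩) | ⟨i, -, rfl⟩) | ⟨C, -, hC, rfl⟩)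
      · simp
      · simp
      · simp
      · rw [SetLike.mem_coe, RingHom.mem_ker, boundary, map_sum]
        refine Finset.sum_eq_zero fun i hi => ?_
        have hne : (C.erase i).card ≠ 0 := by
          rw [Finset.card_erase_of_mem hi]; omega
        have : MvPolynomial.aeval (R := K) (fun _ : Fin n => (0 : K)) (monom K (C.erase i)) = 0 := by
          simp [monom, map_prod, Finset.prod_const, hne]
        rw [map_smul, this, smul_zero])

/-! ### Residues -/

/-- Distinct elements `x`, `y` are parallel when they form a circuit. -/
def Parallel (M : Matroid (Fin n)) (x y : Fin n) : Prop :=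
  x ≠ y ∧ M.IsCircuit {x, y}

/-- The function on ordered sets of the contraction by `x`: `χ_{M/x}(X) = χ(X ∘ x)`. -/
def chiContract (χ : List (Fin n) → K) (x : Fin n) : List (Fin n) → K :=
  fun l => χ (l ++ [x])

/-- The contraction of the matroid by the element `x`. -/
def contr (M : Matroid (Fin n)) (x : Fin n) : Matroid (Fin n) := Matroid.contract M {x}

/-- The defining property of the residue map `𝔭_x : A(M) → A(M/x)`. -/
structure IsResidue (M : Matroid (Fin n)) (χ : List (Fin n) → K) (x : Fin n)
    (f : Alg M χ →ₗ[K] Alg (contr M x) (chiContract χ x)) : Prop where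
  of_mem : ∀ I : Finset (Fin n), M.Indep I → x ∈ I →
    f (cls M χ I) = cls (contr M x) (chiContract χ x) (I.erase x)
  of_parallel : ∀ I : Finset (Fin n), M.Indep I → ∀ y ∈ I, Parallel M x y →
    f (cls M χ I) = (χ ((I.erase y).sort ++ [x]) / χ ((I.erase y).sort ++ [y])) •
      cls (contr M x) (chiContract χ x) (I.erase y)
  otherwise : ∀ I : Finset (Fin n), M.Indep I → x ∉ I → (∀ y ∈ I, ¬ Parallel M x y) →
    f (cls M χ I) = 0

open Classical in
/-- The residue map `𝔭_x : A(M) → A(M/x)`: the linear map with the defining property above. The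
classes `e_I` of the independent sets `I` span `A(M)`, so there is at most one such map; for `x` not
a loop and `χ` coming from a vector configuration or from its contractions it exists (where there is
none, the value is the irrelevant default `0`). -/
def residue (M : Matroid (Fin n)) (χ : List (Fin n) → K) (x : Fin n) :
    Alg M χ →ₗ[K] Alg (contr M x) (chiContract χ x) :=
  if h : ∃ f, IsResidue M χ x f then h.choose else 0

/-- The iterated residue along a reversed ordered set: the residue at the head is applied first. -/
def iterResidueRev : (l : List (Fin n)) → (M : Matroid (Fin n)) → (χ : List (Fin n) → K) →
    (Alg M χ →ₗ[K] K)
  | [], M, χ => (degZero M χ).toLinearMap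
  | x :: l, M, χ => (iterResidueRev l (contr M x) (chiContract χ x)).comp (residue M χ x)

/-- The iterated residue `𝔭_{I^σ} = 𝔭_{i_1} ∘ ⋯ ∘ 𝔭_{i_p}` of the ordered independent set
`I^σ = (i_1, …, i_p)`. On the component of degree `p` the composite takes values in the component
`K` of degree `0` of the algebra of `M/I`. -/
def iterResidue (M : Matroid (Fin n)) (χ : List (Fin n) → K) (l : List (Fin n)) :
    Alg M χ →ₗ[K] K :=
  iterResidueRev l.reverse M χ

/-! ### Diagonal bases -/

/-- `l` is the set `I` with some linear order. -/
def IsOrdering (l : List (Fin n)) (I : Finset (Fin n)) : Prop :=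
  l.Nodup ∧ l.toFinset = I

/-- `Flag(i_1, …, i_p)`: the closures of `{i_p}`, `{i_p, i_{p-1}}`, …, `{i_p, …, i_1}`, in this
order. -/
def flag (M : Matroid (Fin n)) (l : List (Fin n)) : List (Set (Fin n)) :=
  (List.range l.length).map fun k => M.closure {i | i ∈ l.drop (l.length - (k + 1))}

/-- A diagonal basis of the component of degree `ℓ`: a collection `𝓘` of independent `ℓ`-sets, with
a fixed order `σ I` on each `I ∈ 𝓘`, of at least `dim A_ℓ` members, such that no other member `J`
has an order with the same flag as `σ I`. -/
structure IsDiagonalBasis (M : Matroid (Fin n)) (χ : List (Fin n) → K) (ℓ : ℕ)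
    (𝓘 : Finset (Finset (Fin n))) (σ : Finset (Fin n) → List (Fin n)) : Prop where
  indep : ∀ I ∈ 𝓘, M.Indep I ∧ I.card = ℓ
  ordering : ∀ I ∈ 𝓘, IsOrdering (σ I) I
  card_ge : Module.finrank K (piece M χ ℓ) ≤ 𝓘.card
  flag_inj : ∀ I ∈ 𝓘, ∀ J ∈ 𝓘, ∀ l, IsOrdering l J → flag M l = flag M (σ I) → J = I

end Chi

/-! ### The Orlik–Solomon–Terao algebra -/

section OT

variable {K V : Type*} [Field K] [AddCommGroup V] [Module K V] {n : ℕ}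

/-- The subspace spanned by the vectors with index in `F`. -/
abbrev flatSpan (K : Type*) {V : Type*} [Field K] [AddCommGroup V] [Module K V] {n : ℕ}
    (v : Fin n → V) (F : Set (Fin n)) : Submodule K V :=
  Submodule.span K (v '' F)

/-- The choice of an ordered basis `B_F` of the span of the vectors of each flat `F`. -/
abbrev FlatBases (K : Type*) {V : Type*} [Field K] [AddCommGroup V] [Module K V] {n : ℕ}
    (v : Fin n → V) : Type _ :=
  ∀ F : Set (Fin n), (vecMatroid (K := K) v).IsFlat F →
    Module.Basis (Fin (Module.finrank K (flatSpan K v F))) K (flatSpan K v F)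

/-- The flat spanned by an ordered set of indices. -/
abbrev listFlat (K : Type*) {V : Type*} [Field K] [AddCommGroup V] [Module K V] {n : ℕ}
    (v : Fin n → V) (l : List (Fin n)) : Set (Fin n) :=
  (vecMatroid (K := K) v).closure {i | i ∈ l}

/-- The function `χ` of the Orlik–Solomon–Terao algebra: `χ(i_1, …, i_m)` is the determinant of
`v_{i_1}, …, v_{i_m}` with respect to the chosen basis of the span of the flat spanned by
`i_1, …, i_m` when these are distinct and form an independent set (that is, when `m` is the
dimension of that span), and `0` otherwise. -/
def otChi (v : Fin n → V) (B : FlatBases K v) (l : List (Fin n)) : K :=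
  if h : l.length = Module.finrank K (flatSpan K v (listFlat K v l)) then
    (B (listFlat K v l) (Matroid.isFlat_closure _)).det fun j =>
      ⟨v (l.get (Fin.cast h.symm j)), Submodule.subset_span ⟨_,
        Matroid.mem_closure_of_mem _ (List.get_mem l _) (Set.subset_univ _), rfl⟩⟩
  else 0

end OT

end

end OSTerao

namespace OSTerao

noncomputable section

/-! ### Contractions by an element -/

section Contraction

variable {n : ℕ} {M : Matroid (Fin n)}

/-! Two facts give the identity. First, a diagonal basis is a basis of `A_ℓ` whose dual basis
consists of its iterated residues, so `a = ∑_I 𝔭_I(a) e_I` for every `a` in `A_ℓ`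
(`IsDiagonalBasis.expansion`). Second, some linear form `ε` on the algebra takes the value 1 at
`e_J` for every independent `J` (`exists_linearForm`). Applying `ε` to the expansion of `e_J` gives
`1 = ∑_I 𝔭_I(e_J)`.

Duality: a residue at `x` can be nonzero on `e_J` only by deleting from `J` an element equal or
parallel to `x`, that is, one spanning the same flat. If an iterated residue along `I` is nonzero at
`e_J`, the deleted elements therefore order `J` with the flag of `I`, and the diagonal condition
forces `J = I`. On `e_I` itself the value is 1. Hence the `e_I` are independent, and the bound `|𝓘|
≥ dim A_ℓ` makes them a basis.

The residue must also be shown to exist. It is induced by a derivation from the polynomial ring to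
`A(M/x)`, supported on the parallel class of `x`. The properties of `χ` needed for this are
collected in `IsVolume`, which passes to contractions and so permits induction.

The form `ε` sends squarefree monomials with independent support to 1 and all others to 0. For a
circuit `C` and a monomial `m`, the products `m e_{C \ i}` are either all of the first kind or all
of the second, so `m ∂e_C` is sent to a multiple of the signed sum of the `χ(C \ i)`. That sum
vanishes because the vectors lie in an affine hyperplane; only here is that condition needed. -/

theorem contr_indep_iff {x : Fin n} (hx : M.IsNonloop x) {I : Set (Fin n)} :
    (contr M x).Indep I ↔ x ∉ I ∧ M.Indep (insert x I) :=
  hx.contractElem_indep_iff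

theorem contr_closure (x : Fin n) (S : Set (Fin n)) :
    (contr M x).closure S = M.closure (insert x S) \ {x} := by
  rw [contr, Matroid.contract_closure_eq, Set.union_singleton]

theorem closure_insert_parallel {x y : Fin n} (h : Parallel M x y) (S : Set (Fin n)) :
    M.closure (insert x S) = M.closure (insert y S) := by
  have hxy : M.closure {x} = M.closure {y} := by
    have h1 := h.2.closure_sdiff_singleton_eq x
    have h2 := h.2.closure_sdiff_singleton_eq y
    have e1 : ({x, y} : Set (Fin n)) \ {x} = {y} := by
      ext z; have := h.1; simp; grind
    have e2 : ({x, y} : Set (Fin n)) \ {y} = {x} := by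
      ext z; have := h.1; simp; grind
    rw [e1] at h1
    rw [e2] at h2
    rw [h1, h2]
  rw [Set.insert_eq, Set.insert_eq, ← Matroid.closure_union_closure_left_eq, hxy,
    Matroid.closure_union_closure_left_eq]

/-- The elements which are equal or parallel to `x`. -/
def InClass (M : Matroid (Fin n)) (x y : Fin n) : Prop := y = x ∨ Parallel M x y

theorem InClass.closure_insert {x y : Fin n} (h : InClass M x y) (S : Set (Fin n)) :
    M.closure (insert x S) = M.closure (insert y S) := by
  obtain rfl | h := h
  · rfl
  · exact closure_insert_parallel h S

theorem InClass.closure_singleton {x y : Fin n} (h : InClass M x y) :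
    M.closure {x} = M.closure {y} := by
  simpa using h.closure_insert ∅

theorem InClass.isNonloop {x y : Fin n} (hx : M.IsNonloop x) (h : InClass M x y) :
    M.IsNonloop y := by
  obtain rfl | h := h
  · exact hx
  · exact h.2.isNonloop_of_mem ⟨x, by simp, y, by simp, h.1⟩ (by simp)

theorem parallel_of_mem_closure {x y : Fin n} (hx : M.IsNonloop x) (hy : M.IsNonloop y)
    (hxy : x ≠ y) (h : x ∈ M.closure {y}) : Parallel M x y := by
  refine ⟨hxy, ?_⟩
  rw [Matroid.isCircuit_iff_dep_forall_sdiff_singleton_indep]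
  constructor
  · have := (hy.indep.insert_dep_iff (e := x)).2 ⟨h, by simpa using hxy⟩
    exact this
  · intro z hz
    obtain rfl | rfl := hz
    · refine hy.indep.subset ?_
      intro w hw; simp at hw ⊢; grind
    · refine hx.indep.subset ?_
      intro w hw; simp at hw ⊢; grind

theorem InClass.parallel {x y z : Fin n} (hx : M.IsNonloop x) (hy : InClass M x y)
    (hz : InClass M x z) (hyz : y ≠ z) : Parallel M y z := by
  refine parallel_of_mem_closure (hy.isNonloop hx) (hz.isNonloop hx) hyz ?_
  rw [← hz.closure_singleton, hy.closure_singleton]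
  exact M.mem_closure_of_mem' (by simp) (hy.isNonloop hx).mem_ground

theorem InClass.indep_insert_iff {x y : Fin n} (hx : M.IsNonloop x) (h : InClass M x y)
    {S : Set (Fin n)} (hxS : x ∉ S) (hyS : y ∉ S) :
    M.Indep (insert x S) ↔ M.Indep (insert y S) := by
  by_cases hS : M.Indep S
  · have hc : x ∈ M.closure S ↔ y ∈ M.closure S := by
      have hS' := hS.subset_ground
      have hxE := hx.mem_ground
      have hyE := (h.isNonloop hx).mem_ground
      constructor <;> intro hm
      · have := M.closure_subset_closure_of_subset_closure (X := {x}) (Y := S) (by simpa using hm)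
        rw [h.closure_singleton] at this
        exact this (M.mem_closure_of_mem' (by simp) hyE)
      · have := M.closure_subset_closure_of_subset_closure (X := {y}) (Y := S) (by simpa using hm)
        rw [← h.closure_singleton] at this
        exact this (M.mem_closure_of_mem' (by simp) hxE)
    rw [hS.insert_indep_iff_of_notMem hxS, hS.insert_indep_iff_of_notMem hyS]
    simp [hc, hx.mem_ground, (h.isNonloop hx).mem_ground]
  · constructor <;> intro h' <;> exact absurd (h'.subset (Set.subset_insert _ _)) hS

theorem InClass.not_indep_contr {x y : Fin n} (hx : M.IsNonloop x) (h : InClass M x y)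
    {S : Set (Fin n)} (hy : y ∈ S) : ¬ (contr M x).Indep S := by
  rw [contr_indep_iff hx]
  rintro ⟨h1, h2⟩
  obtain rfl | h := h
  · exact h1 hy
  · refine h.2.not_indep (h2.subset ?_)
    intro z hz; simp at hz; grind

/-- Contracting an element of an independent set, up to parallelism. -/
theorem InClass.indep_contr_erase {x y : Fin n} (hx : M.IsNonloop x) (h : InClass M x y)
    {I : Finset (Fin n)} (hI : M.Indep (I : Set (Fin n))) (hy : y ∈ I) :
    (contr M x).Indep (I.erase y : Finset (Fin n)) := by
  have hxI : x ∉ (I.erase y : Finset (Fin n)) := by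
    intro hxI
    obtain rfl | h := h
    · simp at hxI
    · refine h.2.not_indep (hI.subset ?_)
      intro z hz; simp at hz hxI; simp; grind
  rw [contr_indep_iff hx, h.indep_insert_iff hx (by exact_mod_cast hxI) (by simp)]
  refine ⟨by exact_mod_cast hxI, ?_⟩
  rwa [← Finset.coe_insert, Finset.insert_erase hy]

theorem unique_inClass_of_indep {x y z : Fin n} (hx : M.IsNonloop x) {I : Set (Fin n)}
    (hI : M.Indep I) (hyI : y ∈ I) (hzI : z ∈ I) (hy : InClass M x y) (hz : InClass M x z) :
    z = y := by
  by_contra hne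
  refine (hz.parallel hx hy hne).2.not_indep (hI.subset ?_)
  intro w hw; simp at hw; grind

theorem isCircuit_finset_iff {C : Finset (Fin n)} :
    M.IsCircuit (C : Set (Fin n)) ↔
      M.Dep (C : Set (Fin n)) ∧ ∀ i ∈ C, M.Indep (C.erase i : Finset (Fin n)) := by
  rw [Matroid.isCircuit_iff_dep_forall_sdiff_singleton_indep]
  simp

theorem indep_erase {C : Finset (Fin n)} (hC : M.IsCircuit (C : Set (Fin n))) {i : Fin n}
    (hi : i ∈ C) : M.Indep (C.erase i : Finset (Fin n)) :=
  (isCircuit_finset_iff.1 hC).2 i hi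

theorem closure_erase {C : Finset (Fin n)} (hC : M.IsCircuit (C : Set (Fin n))) (i : Fin n) :
    M.closure (C.erase i : Finset (Fin n)) = M.closure C := by
  rw [Finset.coe_erase, hC.closure_sdiff_singleton_eq]

/-- A circuit whose span avoids `x` is a circuit of the contraction. -/
theorem isCircuit_contr_of_notMem_closure {x : Fin n} (hx : M.IsNonloop x) {C : Finset (Fin n)}
    (hC : M.IsCircuit (C : Set (Fin n))) (hxC : x ∉ M.closure (C : Set (Fin n))) :
    (contr M x).IsCircuit (C : Set (Fin n)) := by
  have hxC' : x ∉ C := fun h => hxC (M.mem_closure_of_mem' (by exact_mod_cast h) hx.mem_ground)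
  rw [isCircuit_finset_iff]
  refine ⟨⟨?_, ?_⟩, fun i hi => ?_⟩
  · rw [contr_indep_iff hx]
    exact fun h => hC.not_indep (h.2.subset (Set.subset_insert _ _))
  · intro z hz
    exact ⟨hC.subset_ground hz, by rintro rfl; exact hxC' (by exact_mod_cast hz)⟩
  · rw [contr_indep_iff hx]
    have hxe : x ∉ ((C.erase i : Finset (Fin n)) : Set (Fin n)) := by simp [hxC']
    refine ⟨hxe, ?_⟩
    rw [(indep_erase hC hi).insert_indep_iff_of_notMem hxe, closure_erase hC]
    exact ⟨hx.mem_ground, hxC⟩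

/-- Removing one element from a circuit does not change its span, so `x` remains spanned. Every term
of `∂e_C` then vanishes in `A(M/x)`. -/
theorem not_indep_contr_erase {x : Fin n} (hx : M.IsNonloop x) {C : Finset (Fin n)}
    (hC : M.IsCircuit (C : Set (Fin n))) (hxC : x ∈ M.closure (C : Set (Fin n))) (i : Fin n)
    : ¬ (contr M x).Indep (C.erase i : Finset (Fin n)) := by
  rw [contr_indep_iff hx]
  rintro ⟨h1, h2⟩
  have := (h2.subset (Set.subset_insert _ _)).insert_indep_iff_of_notMem h1
  rw [this, closure_erase hC] at h2
  exact h2.2 hxC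

/-- Removing from a circuit an element equal or parallel to `x` gives a circuit of the contraction
by `x`. -/
theorem isCircuit_contr_erase {x y : Fin n} (hx : M.IsNonloop x) {C : Finset (Fin n)}
    (hC : M.IsCircuit (C : Set (Fin n))) (h : InClass M x y) (hy : y ∈ C) (hcard : 3 ≤ C.card) :
    (contr M x).IsCircuit (C.erase y : Finset (Fin n)) := by
  -- Two class elements of `C` would already form a circuit, hence be all of `C`.
  have huniq : ∀ z ∈ C, InClass M x z → z = y := by
    intro z hz hzx
    by_contra hne
    have hp := (hzx.parallel hx h hne).2
    have : ({z, y} : Set (Fin n)) = C := hC.eq_of_dep_subset hp.dep (by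
      intro w hw; simp at hw; simp; grind)
    have h2 : C = {z, y} := by ext w; rw [← Finset.mem_coe, ← this]; simp
    rw [h2] at hcard
    have := Finset.card_le_two (a := z) (b := y)
    omega
  have hxC : x ∈ M.closure (C : Set (Fin n)) := by
    have := M.closure_subset_closure (X := {y}) (Y := (C : Set (Fin n))) (by simpa using hy)
    rw [← h.closure_singleton] at this
    exact this (M.mem_closure_of_mem' (by simp) hx.mem_ground)
  have hxe : x ∉ C.erase y := by
    intro hxe
    have := huniq x (Finset.mem_of_mem_erase hxe) (Or.inl rfl)
    simp [this] at hxe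
  rw [isCircuit_finset_iff]
  refine ⟨⟨not_indep_contr_erase hx hC hxC y, ?_⟩, fun i hi => ?_⟩
  · intro z hz
    refine ⟨hC.subset_ground ?_, ?_⟩
    · exact_mod_cast Finset.mem_of_mem_erase (by exact_mod_cast hz)
    · rintro rfl; exact hxe (by exact_mod_cast hz)
  · have hne := Finset.ne_of_mem_erase hi
    rw [Finset.erase_right_comm]
    exact h.indep_contr_erase hx (indep_erase hC (Finset.mem_of_mem_erase hi))
      (Finset.mem_erase.2 ⟨hne.symm, hy⟩)

end Contraction

/-! ### Ordered independent sets -/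

section Lists

variable {n : ℕ} {M : Matroid (Fin n)}

/-- `l` has no repetition and its elements form an independent set. -/
def IndepList (M : Matroid (Fin n)) (l : List (Fin n)) : Prop :=
  l.Nodup ∧ M.Indep {i | i ∈ l}

theorem setOf_mem_sort (I : Finset (Fin n)) : {i | i ∈ I.sort} = (I : Set (Fin n)) := by
  ext; simp

theorem indepList_sort {I : Finset (Fin n)} : IndepList M I.sort ↔ M.Indep (I : Set (Fin n)) := by
  rw [IndepList, setOf_mem_sort]
  exact and_iff_right (Finset.sort_nodup ..)

theorem setOf_mem_cons (x : Fin n) (l : List (Fin n)) :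
    {i | i ∈ x :: l} = insert x {i | i ∈ l} := by
  ext; simp

theorem setOf_mem_append_singleton (x : Fin n) (l : List (Fin n)) :
    {i | i ∈ l ++ [x]} = insert x {i | i ∈ l} := by
  ext; simp [or_comm]

theorem IndepList.of_cons {x : Fin n} {l : List (Fin n)} (h : IndepList M (x :: l)) :
    IndepList M l :=
  ⟨h.1.of_cons, h.2.subset (by rw [setOf_mem_cons]; exact Set.subset_insert _ _)⟩

theorem IndepList.perm {l l' : List (Fin n)} (h : IndepList M l) (hp : l.Perm l') :
    IndepList M l' := by
  refine ⟨hp.nodup_iff.1 h.1, ?_⟩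
  have : {i | i ∈ l'} = {i | i ∈ l} := by ext; simp [hp.mem_iff]
  rw [this]; exact h.2

theorem indepList_cons {x : Fin n} {l : List (Fin n)} :
    IndepList M (x :: l) ↔ x ∈ M.E ∧ x ∉ M.closure {i | i ∈ l} ∧ IndepList M l := by
  constructor
  · intro h
    have hl := h.of_cons
    have h2 := h.2
    have hx : x ∉ {i | i ∈ l} := (List.nodup_cons.1 h.1).1
    rw [setOf_mem_cons, hl.2.insert_indep_iff_of_notMem hx] at h2
    exact ⟨h2.1, h2.2, hl⟩
  · rintro ⟨hE, hx, hl⟩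
    have hx' : x ∉ {i | i ∈ l} := fun h => hx (M.mem_closure_of_mem h hl.2.subset_ground)
    refine ⟨List.nodup_cons.2 ⟨hx', hl.1⟩, ?_⟩
    rw [setOf_mem_cons, hl.2.insert_indep_iff_of_notMem hx']
    exact ⟨hE, hx⟩

theorem indepList_contr_iff {x : Fin n} (hx : M.IsNonloop x) {l : List (Fin n)} :
    IndepList (contr M x) l ↔ IndepList M (l ++ [x]) := by
  rw [IndepList, IndepList, contr_indep_iff hx, setOf_mem_append_singleton,
    List.nodup_append_comm]
  simp only [List.singleton_append, List.nodup_cons, Set.mem_ofPred_eq]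
  tauto

theorem IndepList.isNonloop_head {x : Fin n} {l : List (Fin n)} (h : IndepList M (x :: l)) :
    M.IsNonloop x :=
  h.2.isNonloop_of_mem (by simp)

theorem IndepList.tail_contr {x : Fin n} {l : List (Fin n)} (h : IndepList M (x :: l)) :
    IndepList (contr M x) l :=
  (indepList_contr_iff h.isNonloop_head).2 (h.perm (by simpa using List.perm_append_comm (l₁ := [x])))

end Lists

/-! ### Functions on ordered sets behaving like volumes -/

section Volume

variable {K : Type*} [Field K] {n : ℕ} {M : Matroid (Fin n)} {χ : List (Fin n) → K}

/-- `χ` behaves like the determinants of a vector configuration representing `M`, each one computed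
in a basis of the span of its arguments. -/
structure IsVolume (M : Matroid (Fin n)) (χ : List (Fin n) → K) : Prop where
  ne_zero : ∀ l, IndepList M l → χ l ≠ 0
  swap : ∀ l₁ a b l₂, χ (l₁ ++ a :: b :: l₂) = -χ (l₁ ++ b :: a :: l₂)
  -- For `l`, `l'` bases of one flat, adjoining `a` multiplies both volumes by the same factor,
  -- whatever bases the determinants are computed in.
  cons_mul : ∀ a l l', IndepList M (a :: l) → IndepList M l' →
    M.closure {i | i ∈ l} = M.closure {i | i ∈ l'} → χ (a :: l) * χ l' = χ (a :: l') * χ l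

/-- Iterates `cons_mul` along `m`; independence and equality of closures are carried along because
each application of `cons_mul` needs them. -/
theorem IsVolume.append_mul (h : IsVolume M χ) (m l l' : List (Fin n)) (hl : IndepList M (m ++ l))
    (hl' : IndepList M l') (hcl : M.closure {i | i ∈ l} = M.closure {i | i ∈ l'}) :
    IndepList M (m ++ l') ∧ M.closure {i | i ∈ m ++ l} = M.closure {i | i ∈ m ++ l'} ∧
      χ (m ++ l) * χ l' = χ (m ++ l') * χ l := by
  induction m with
  | nil => exact ⟨hl', hcl, mul_comm _ _⟩
  | cons a m ih =>
    obtain ⟨h1, h2, h3⟩ := ih hl.of_cons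
    simp only [List.cons_append] at hl ⊢
    have h4 := h.cons_mul a _ _ hl h1 h2
    have hne := h.ne_zero _ h1
    refine ⟨?_, ?_, ?_⟩
    · rw [indepList_cons] at hl ⊢
      exact ⟨hl.1, h2 ▸ hl.2.1, h1⟩
    · rw [setOf_mem_cons, setOf_mem_cons]
      exact M.closure_insert_congr_right h2
    · apply mul_right_cancel₀ hne
      linear_combination χ l' * h4 + χ (a :: (m ++ l')) * h3

theorem IsVolume.move (h : IsVolume M χ) (l₁ : List (Fin n)) (x : Fin n) (l₂ l₃ : List (Fin n)) :
    χ (l₁ ++ x :: (l₂ ++ l₃)) = (-1) ^ l₂.length * χ (l₁ ++ (l₂ ++ x :: l₃)) := by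
  induction l₂ generalizing l₁ with
  | nil => simp
  | cons a l₂ ih =>
    have := ih (l₁ ++ [a])
    simp only [List.append_assoc, List.singleton_append] at this
    rw [List.cons_append, h.swap, this, List.length_cons, pow_succ]
    simp

theorem IsVolume.cons_eq_append (h : IsVolume M χ) (x : Fin n) (l : List (Fin n)) :
    χ (x :: l) = (-1) ^ l.length * χ (l ++ [x]) := by
  simpa using h.move [] x l []

/-- Each axiom for `M/x` at `l` is the axiom for `M` at `l ++ [x]`. Closures in `M/x` are closures
in `M` with `x` removed, so reinserting `x` recovers the hypothesis of `cons_mul`. -/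
theorem IsVolume.contract (h : IsVolume M χ) {x : Fin n} (hx : M.IsNonloop x) :
    IsVolume (contr M x) (chiContract χ x) where
  ne_zero l hl := h.ne_zero _ ((indepList_contr_iff hx).1 hl)
  swap l₁ a b l₂ := by simpa [chiContract] using h.swap l₁ a b (l₂ ++ [x])
  cons_mul a l l' hl hl' hcl := by
    rw [indepList_contr_iff hx] at hl hl'
    refine h.cons_mul a (l ++ [x]) (l' ++ [x]) hl hl' ?_
    have hmem (l : List (Fin n)) : x ∈ M.closure (insert x {i | i ∈ l}) :=
      M.mem_closure_of_mem' (by simp) hx.mem_ground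
    rw [contr_closure, contr_closure] at hcl
    rw [setOf_mem_append_singleton, setOf_mem_append_singleton]
    have := congrArg (insert x) hcl
    rwa [Set.insert_sdiff_singleton, Set.insert_sdiff_singleton, Set.insert_eq_of_mem (hmem _),
      Set.insert_eq_of_mem (hmem _)] at this

theorem sort_split {I : Finset (Fin n)} {y : Fin n} (hy : y ∈ I) :
    I.sort = (I.filter (· < y)).sort ++ y :: (I.filter (y < ·)).sort := by
  refine List.Perm.eq_of_pairwise (le := (· ≤ ·)) (fun a b _ _ => le_antisymm)
    (Finset.pairwise_sort ..) ?_ ?_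
  · rw [List.pairwise_append]
    refine ⟨Finset.pairwise_sort .., List.pairwise_cons.2 ⟨?_, Finset.pairwise_sort ..⟩, ?_⟩
    · intro b hb; simp at hb; exact hb.2.le
    · intro a ha b hb
      simp at ha hb
      obtain rfl | hb := hb
      · exact ha.2.le
      · exact (ha.2.trans hb.2).le
  · rw [List.perm_ext_iff_of_nodup (Finset.sort_nodup ..)]
    · intro a
      simp
      constructor
      · intro ha; have := lt_trichotomy a y; grind
      · grind
    · rw [List.nodup_append]
      refine ⟨Finset.sort_nodup .., List.nodup_cons.2 ⟨by simp, Finset.sort_nodup ..⟩, ?_⟩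
      intro a ha b hb
      simp at ha hb
      obtain rfl | hb := hb
      · exact ha.2.ne
      · exact (ha.2.trans hb.2).ne

/-- Moving `y` to the end of the increasing list of the elements of `I`. -/
theorem IsVolume.sort_eq (h : IsVolume M χ) {I : Finset (Fin n)} {y : Fin n} (hy : y ∈ I) :
    χ I.sort = (-1) ^ (I.filter (y < ·)).card * χ ((I.erase y).sort ++ [y]) := by
  have h1 : (I.erase y).sort = (I.filter (· < y)).sort ++ (I.filter (y < ·)).sort := by
    have e := sort_split hy
    refine List.Perm.eq_of_pairwise (le := (· ≤ ·)) (fun a b _ _ => le_antisymm)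
      (Finset.pairwise_sort ..) ?_ ?_
    · have := Finset.pairwise_sort I (· ≤ ·)
      rw [e, List.pairwise_append, List.pairwise_cons] at this
      rw [List.pairwise_append]
      exact ⟨this.1, this.2.1.2, fun a ha b hb => this.2.2 a ha b (List.mem_cons_of_mem _ hb)⟩
    · have hn := Finset.sort_nodup I (· ≤ ·)
      rw [e] at hn
      rw [List.perm_ext_iff_of_nodup (Finset.sort_nodup ..) (List.nodup_middle.1 hn).of_cons]
      intro a
      simp
      grind
  rw [h1, sort_split hy, List.append_assoc]
  have := h.move (I.filter (· < y)).sort y (I.filter (y < ·)).sort []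
  simpa using this

/-- The ratio of `χ` at parallel elements. -/
theorem IsVolume.parallel_ratio (h : IsVolume M χ) {x y : Fin n} (hx : M.IsNonloop x)
    (hxy : InClass M x y) (m : List (Fin n)) (hm : IndepList M (m ++ [y])) :
    χ (m ++ [x]) = χ [x] / χ [y] * χ (m ++ [y]) := by
  have hy := hxy.isNonloop hx
  have hx' : IndepList M [x] := ⟨by simp, by simpa using hx⟩
  have hy' : IndepList M [y] := ⟨by simp, by simpa using hy⟩
  have := (h.append_mul m [y] [x] hm hx' (by simpa using hxy.closure_singleton.symm)).2.2
  have hne := h.ne_zero _ hy'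
  field_simp
  linear_combination -this

end Volume

/-! ### Dependent monomials vanish -/

section Vanishing

variable {K : Type*} [Field K] {n : ℕ} {M : Matroid (Fin n)} {χ : List (Fin n) → K}

theorem mk_monom (X : Finset (Fin n)) :
    Ideal.Quotient.mk (Ideal.span (relations M χ)) (monom K X) = cls M χ X := rfl

theorem mk_relation {f : MvPolynomial (Fin n) K} (hf : f ∈ relations M χ) :
    Ideal.Quotient.mk (Ideal.span (relations M χ)) f = 0 :=
  Ideal.Quotient.eq_zero_iff_mem.2 (Ideal.subset_span hf)

theorem mk_X_sq (i : Fin n) :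
    (Ideal.Quotient.mk (Ideal.span (relations M χ)) (MvPolynomial.X i)) ^ 2 = 0 := by
  rw [← map_pow]
  exact mk_relation (Or.inl (Or.inl (Or.inl ⟨i, rfl⟩)))

theorem mk_boundary {C : Finset (Fin n)} (hC : M.IsCircuit (C : Set (Fin n))) (hcard : 1 < C.card) :
    Ideal.Quotient.mk (Ideal.span (relations M χ)) (boundary χ C) = 0 :=
  mk_relation (Or.inr ⟨C, hC, hcard, rfl⟩)

theorem mk_boundary_eq_sum {χ' : List (Fin n) → K} (C : Finset (Fin n)) :
    Ideal.Quotient.mk (Ideal.span (relations M χ)) (boundary χ' C) =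
      ∑ i ∈ C, ((-1 : K) ^ (C.filter (fun j => j ≤ i)).card * χ' (C.erase i).sort) •
        cls M χ (C.erase i) := by
  rw [boundary, map_sum]; rfl

theorem cls_eq_mul_erase {J : Finset (Fin n)} {i : Fin n} (hi : i ∈ J) :
    cls M χ J = Ideal.Quotient.mk _ (MvPolynomial.X i) * cls M χ (J.erase i) := by
  rw [cls, cls, ← map_mul, monom, monom, Finset.mul_prod_erase _ _ hi]

theorem cls_eq_zero_of_subset {J J' : Finset (Fin n)} (h : J ⊆ J') (hJ : cls M χ J = 0) :
    cls M χ J' = 0 := by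
  have : cls M χ J' = cls M χ (J' \ J) * cls M χ J := by
    rw [cls, cls, cls, ← map_mul, monom, monom, monom, Finset.prod_sdiff h]
  rw [this, hJ, mul_zero]

/-- Multiplying `∂e_C` by `e_i` with `i ∈ C` kills every term but that of `C \ i`, because `e_i ^ 2
= 0`; what remains is a nonzero multiple of `e_C`. One-element circuits are loops. -/
theorem cls_circuit (h : IsVolume M χ) {C : Finset (Fin n)}
    (hC : M.IsCircuit (C : Set (Fin n))) : cls M χ C = 0 := by
  obtain ⟨i, hi⟩ := hC.nonempty
  replace hi : i ∈ C := hi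
  by_cases hcard : 1 < C.card
  · have h1 := mk_boundary (χ := χ) hC hcard
    rw [mk_boundary_eq_sum] at h1
    have h2 := congrArg (Ideal.Quotient.mk (Ideal.span (relations M χ)) (MvPolynomial.X i) * ·) h1
    simp only [Finset.mul_sum, mul_zero, mul_smul_comm] at h2
    rw [Finset.sum_eq_single i] at h2
    · rw [← cls_eq_mul_erase hi] at h2
      refine (smul_eq_zero.1 h2).resolve_left ?_
      exact mul_ne_zero (pow_ne_zero _ (by simp)) (h.ne_zero _ (indepList_sort.2 (indep_erase hC hi)))
    · intro j hj hji
      rw [cls_eq_mul_erase (J := C.erase j) (i := i) (by simp [hi, hji.symm]), ← mul_assoc, ← sq,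
        mk_X_sq, zero_mul, smul_zero]
    · exact fun h => absurd hi h
  · have hC1 : C = {i} := by
      have : C.card = 1 := le_antisymm (not_lt.1 hcard) (Finset.card_pos.2 ⟨i, hi⟩)
      obtain ⟨j, rfl⟩ := Finset.card_eq_one.1 this
      simp at hi; rw [hi]
    subst hC1
    have : M.IsLoop i := by simpa using hC
    simpa [cls, monom] using mk_relation (χ := χ) (Or.inl (Or.inr ⟨i, this, rfl⟩))

theorem cls_eq_zero (h : IsVolume M χ) {J : Finset (Fin n)} (hJ : ¬ M.Indep (J : Set (Fin n))) :
    cls M χ J = 0 := by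
  by_cases hE : (J : Set (Fin n)) ⊆ M.E
  · obtain ⟨C, hCJ, hC⟩ := Matroid.Dep.exists_isCircuit_subset ⟨hJ, hE⟩
    lift C to Finset (Fin n) using Set.toFinite C
    exact cls_eq_zero_of_subset (by exact_mod_cast hCJ) (cls_circuit h hC)
  · obtain ⟨i, hi, hiE⟩ := Set.not_subset.1 hE
    refine cls_eq_zero_of_subset (J := {i}) (by simpa using hi) ?_
    simpa [cls, monom] using
      mk_relation (M := M) (χ := χ) (Or.inl (Or.inl (Or.inr ⟨i, hiE, rfl⟩)))

end Vanishing

/-! ### Residues exist -/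

section Residue

variable {K : Type*} [Field K] {n : ℕ} {M : Matroid (Fin n)} {χ : List (Fin n) → K} {x : Fin n}

theorem mk_X_eq_zero_of_inClass (h : IsVolume M χ) (hx : M.IsNonloop x) {y : Fin n}
    (hy : InClass M x y) :
    Ideal.Quotient.mk (Ideal.span (relations (contr M x) (chiContract χ x)))
      (MvPolynomial.X y) = 0 := by
  have := cls_eq_zero (h.contract hx) (J := {y}) (hy.not_indep_contr hx (by simp))
  simpa [cls, monom] using this

/-- A circuit relation with span avoiding `x` is a multiple of one of the contraction. -/
theorem IsVolume.circuit_ratio (h : IsVolume M χ) (hx : M.IsNonloop x) {C : Finset (Fin n)}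
    (hC : M.IsCircuit (C : Set (Fin n))) (hxC : x ∉ M.closure (C : Set (Fin n))) :
    ∃ c : K, ∀ i ∈ C, χ (C.erase i).sort = c * chiContract χ x (C.erase i).sort := by
  obtain ⟨k, hk⟩ := hC.nonempty
  have hcons : ∀ i ∈ C, IndepList M (x :: (C.erase i).sort) := fun i hi => by
    rw [indepList_cons, setOf_mem_sort, closure_erase hC]
    exact ⟨hx.mem_ground, hxC, indepList_sort.2 (indep_erase hC hi)⟩
  -- All `C \ i` span the same flat, so adjoining `x` scales their volumes by a common factor; the
  -- sign of moving `x` to the end depends only on `|C|`.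
  refine ⟨χ (C.erase k).sort / chiContract χ x (C.erase k).sort, fun i hi => ?_⟩
  have h1 := h.cons_mul x _ _ (hcons i hi) (hcons k hk).of_cons (by
    rw [setOf_mem_sort, setOf_mem_sort, closure_erase hC, closure_erase hC])
  have hne := h.ne_zero _ (hcons k hk)
  rw [h.cons_eq_append] at hne
  rw [h.cons_eq_append, h.cons_eq_append] at h1
  simp only [Finset.length_sort, Finset.card_erase_of_mem hi,
    Finset.card_erase_of_mem (Finset.mem_coe.1 hk)] at h1 hne
  have hs := left_ne_zero_of_mul hne
  have hne' := right_ne_zero_of_mul hne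
  rw [chiContract, chiContract]
  field_simp
  apply mul_left_cancel₀ hs
  linear_combination -h1

theorem mk_contr_boundary (h : IsVolume M χ) (hx : M.IsNonloop x) {C : Finset (Fin n)}
    (hC : M.IsCircuit (C : Set (Fin n))) (hcard : 1 < C.card) :
    Ideal.Quotient.mk (Ideal.span (relations (contr M x) (chiContract χ x))) (boundary χ C) = 0 := by
  by_cases hxC : x ∈ M.closure (C : Set (Fin n))
  · rw [mk_boundary_eq_sum]
    exact Finset.sum_eq_zero fun i _ => by
      rw [cls_eq_zero (h.contract hx) (not_indep_contr_erase hx hC hxC i), smul_zero]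
  · obtain ⟨c, hc⟩ := h.circuit_ratio hx hC hxC
    have h1 := mk_boundary (χ := chiContract χ x) (isCircuit_contr_of_notMem_closure hx hC hxC) hcard
    rw [mk_boundary_eq_sum] at h1 ⊢
    have h2 := congrArg (c • ·) h1
    simp only [Finset.smul_sum, smul_zero, smul_smul] at h2
    rw [← h2]
    refine Finset.sum_congr rfl fun i hi => ?_
    rw [hc i hi]
    congr 1; ring

open Classical in
/-- The weighted derivative along the parallel class of `x`. -/
def classDerivation (M : Matroid (Fin n)) (χ : List (Fin n) → K) (x : Fin n) :
    Derivation K (MvPolynomial (Fin n) K) (Alg (contr M x) (chiContract χ x)) :=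
  -- By `parallel_ratio` this weight is the coefficient in the definition of the residue, which is
  -- therefore the same for all `I` containing `y`.
  MvPolynomial.mkDerivation K fun y => if InClass M x y then (χ [x] / χ [y]) • 1 else 0

theorem classDerivation_X {y : Fin n} (hy : InClass M x y) :
    classDerivation M χ x (MvPolynomial.X y) = (χ [x] / χ [y]) • 1 := by
  rw [classDerivation, MvPolynomial.mkDerivation_X, if_pos hy]

theorem classDerivation_X_of_not {y : Fin n} (hy : ¬ InClass M x y) :
    classDerivation M χ x (MvPolynomial.X y) = 0 := by
  rw [classDerivation, MvPolynomial.mkDerivation_X, if_neg hy]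

theorem smul_alg_eq (M : Matroid (Fin n)) (χ : List (Fin n) → K) (f : MvPolynomial (Fin n) K)
    (a : Alg M χ) : f • a = Ideal.Quotient.mk _ f * a :=
  Algebra.smul_def f a

theorem classDerivation_monom_of_not {T : Finset (Fin n)} (hT : ∀ y ∈ T, ¬ InClass M x y) :
    classDerivation M χ x (monom K T) = 0 := by
  induction T using Finset.induction_on with
  | empty => simp [monom]
  | insert a T ha ih =>
    rw [monom, Finset.prod_insert ha, Derivation.leibniz, classDerivation_X_of_not (hT a (by simp))]
    change _ • classDerivation M χ x (monom K T) + _ = _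
    rw [ih fun y hy => hT y (by simp [hy])]
    simp

theorem classDerivation_monom {T : Finset (Fin n)} {y : Fin n} (hyT : y ∈ T)
    (hy : InClass M x y) (hT : ∀ z ∈ T, InClass M x z → z = y) :
    classDerivation M χ x (monom K T) =
      (χ [x] / χ [y]) • cls (contr M x) (chiContract χ x) (T.erase y) := by
  have : monom K T = MvPolynomial.X y * monom K (T.erase y) := by
    rw [monom, monom, Finset.mul_prod_erase _ _ hyT]
  rw [this, Derivation.leibniz, classDerivation_X hy, classDerivation_monom_of_not, smul_zero,
    zero_add, smul_comm, smul_alg_eq, mk_monom, mul_one]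
  intro z hz hzx
  exact Finset.ne_of_mem_erase hz (hT z (Finset.mem_of_mem_erase hz) hzx)

/-- Compares the sign of `i` in `∂e_C` with its sign in `∂e_{C \ y}`. If `i < y`, neither deletion
affects the counts; if `i > y`, each lowers one count by one. -/
theorem card_filter_erase_sign {C : Finset (Fin n)} {i y : Fin n} (hi : i ∈ C) (hy : y ∈ C)
    (hiy : i ≠ y) :
    (-1 : K) ^ (C.filter (fun j => j ≤ i)).card * (-1) ^ ((C.erase i).filter (y < ·)).card =
      (-1) ^ (C.filter (y < ·)).card * (-1) ^ ((C.erase y).filter (fun j => j ≤ i)).card := by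
  rw [Finset.filter_erase, Finset.filter_erase]
  rcases lt_or_gt_of_ne hiy with hlt | hlt
  · rw [Finset.erase_eq_of_notMem (s := C.filter (y < ·)) (by simp [hlt.le]),
      Finset.erase_eq_of_notMem (a := y) (by simp [hlt])]
    ring
  · have h1 : i ∈ C.filter (y < ·) := by simp [hi, hlt]
    have h2 : y ∈ C.filter (fun j => j ≤ i) := by simp [hy, hlt.le]
    rw [← Finset.card_erase_add_one h1, ← Finset.card_erase_add_one h2]
    ring

/-- If `C` has at least three elements and meets the class of `x`, it does so in a single `y`: the
term without `y` dies and the others add up to plus or minus the boundary of the circuit `C \ y` of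
`M/x`. If `C = {y, z}`, both elements lie in the class and the two terms are `χ[x]` with opposite
signs. -/
theorem classDerivation_boundary (h : IsVolume M χ) (hx : M.IsNonloop x) {C : Finset (Fin n)}
    (hC : M.IsCircuit (C : Set (Fin n))) (hcard : 1 < C.card) :
    classDerivation M χ x (boundary χ C) = 0 := by
  have hsum : classDerivation M χ x (boundary χ C) =
      ∑ i ∈ C, ((-1 : K) ^ (C.filter (fun j => j ≤ i)).card * χ (C.erase i).sort) •
        classDerivation M χ x (monom K (C.erase i)) := by
    rw [boundary, map_sum]
    exact Finset.sum_congr rfl fun i _ => by rw [Derivation.map_smul]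
  rw [hsum]
  by_cases hCX : ∀ y ∈ C, ¬ InClass M x y
  · exact Finset.sum_eq_zero fun i _ => by
      rw [classDerivation_monom_of_not fun y hy => hCX y (Finset.mem_of_mem_erase hy), smul_zero]
  push Not at hCX
  obtain ⟨y, hyC, hy⟩ := hCX
  have huniq : ∀ z ∈ C, InClass M x z → z = y ∨ C = {y, z} := by
    intro z hz hzx
    by_contra! hne
    have hp := (hy.parallel hx hzx hne.1.symm).2
    have : ({y, z} : Set (Fin n)) = C := hC.eq_of_dep_subset hp.dep (by
      intro w hw; simp at hw; simp; grind)
    exact hne.2 (by ext w; rw [← Finset.mem_coe, ← this]; simp)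
  by_cases hcard3 : 3 ≤ C.card
  · have huniq' : ∀ z ∈ C, InClass M x z → z = y := by
      intro z hz hzx
      refine (huniq z hz hzx).resolve_right fun h2 => ?_
      rw [h2] at hcard3
      have := Finset.card_le_two (a := y) (b := z)
      omega
    rw [← Finset.add_sum_erase _ _ hyC, classDerivation_monom_of_not (T := C.erase y) (fun z hz hzx =>
      Finset.ne_of_mem_erase hz (huniq' z (Finset.mem_of_mem_erase hz) hzx)), smul_zero, zero_add]
    have h1 := mk_boundary (χ := chiContract χ x) (isCircuit_contr_erase hx hC hy hyC hcard3)
      (by rw [Finset.card_erase_of_mem hyC]; omega)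
    rw [mk_boundary_eq_sum] at h1
    have h2 := congrArg (((-1 : K) ^ (C.filter (y < ·)).card) • ·) h1
    simp only [Finset.smul_sum, smul_zero, smul_smul] at h2
    rw [← h2]
    refine Finset.sum_congr rfl fun i hi => ?_
    have hiC := Finset.mem_of_mem_erase hi
    have hiy := Finset.ne_of_mem_erase hi
    have hyi : y ∈ C.erase i := Finset.mem_erase.2 ⟨hiy.symm, hyC⟩
    rw [classDerivation_monom hyi hy fun z hz => huniq' z (Finset.mem_of_mem_erase hz), smul_smul,
      chiContract, h.sort_eq hyi, Finset.erase_right_comm (a := i)]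
    have hm : IndepList M (((C.erase i).erase y).sort ++ [y]) := by
      have := indep_erase hC hiC
      rw [← Finset.insert_erase hyi, ← indepList_sort, Finset.insert_erase hyi] at this
      refine this.perm ?_
      rw [List.perm_ext_iff_of_nodup this.1]
      · intro a; simp; grind
      · rw [List.nodup_append_comm]; simp
    rw [Finset.erase_right_comm (a := i)] at hm
    rw [h.parallel_ratio hx hy _ hm]
    congr 1
    linear_combination (χ (((C.erase y).erase i).sort ++ [y]) * (χ [x] / χ [y])) *
      card_filter_erase_sign (K := K) hiC hyC hiy
  · obtain ⟨z, hzC, hzy⟩ := Finset.exists_mem_ne hcard y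
    have hCyz : C = {y, z} := by
      refine (Finset.eq_of_subset_of_card_le ?_ ?_).symm
      · intro w hw; simp at hw; grind
      · rw [Finset.card_pair hzy.symm]; omega
    subst hCyz
    have hyz : Parallel M y z := ⟨hzy.symm, by simpa using hC⟩
    have hzx : InClass M x z := by
      by_cases hxz : z = x
      · exact Or.inl hxz
      · refine Or.inr (parallel_of_mem_closure hx (InClass.isNonloop (hy.isNonloop hx)
          (Or.inr hyz)) (Ne.symm hxz) ?_)
        rw [← InClass.closure_singleton (Or.inr hyz), ← hy.closure_singleton]
        exact M.mem_closure_of_mem' (by simp) hx.mem_ground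
    have e1 : ({y, z} : Finset (Fin n)).erase y = {z} := by ext; simp; grind
    have e2 : ({y, z} : Finset (Fin n)).erase z = {y} := by ext; simp; grind
    have hne {w : Fin n} (hw : InClass M x w) : χ [w] ≠ 0 :=
      h.ne_zero _ ⟨by simp, by simpa using hw.isNonloop hx⟩
    rw [Finset.sum_pair hzy.symm, e1, e2, classDerivation_monom (y := z) (by simp) hzx (by simp),
      classDerivation_monom (y := y) (by simp) hy (by simp)]
    simp only [Finset.sort_singleton, smul_smul, Finset.erase_singleton, ← add_smul]
    have : (-1 : K) ^ (({y, z} : Finset (Fin n)).filter (fun j => j ≤ y)).card +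
        (-1) ^ (({y, z} : Finset (Fin n)).filter (fun j => j ≤ z)).card = 0 := by
      rcases lt_or_gt_of_ne hzy with hlt | hlt
      · rw [Finset.filter_insert, if_pos le_rfl, Finset.filter_singleton, if_pos hlt.le,
          Finset.filter_insert, if_neg (not_le.2 hlt), Finset.filter_singleton, if_pos le_rfl,
          Finset.card_pair hzy.symm]
        simp
      · rw [Finset.filter_insert, if_pos le_rfl, Finset.filter_singleton, if_neg (not_le.2 hlt),
          Finset.filter_insert, if_pos hlt.le, Finset.filter_singleton, if_pos le_rfl,
          Finset.card_pair hzy.symm]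
        simp
    convert zero_smul K _
    have h1 := hne hy
    have h2 := hne hzx
    field_simp
    linear_combination χ [x] * this

/-- By Leibniz, `D(af) = a D(f) + f D(a)`, so the induction over the ideal must also carry that `f`
vanishes in `A(M/x)`. For squares, `D(e_i ^ 2) = 2 e_i D(e_i)`, and `e_i` is zero in `A(M/x)` when
`i` is in the class. -/
theorem classDerivation_ideal (h : IsVolume M χ) (hx : M.IsNonloop x)
    {f : MvPolynomial (Fin n) K} (hf : f ∈ Ideal.span (relations M χ)) :
    classDerivation M χ x f = 0 := by
  suffices H : classDerivation M χ x f = 0 ∧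
      Ideal.Quotient.mk (Ideal.span (relations (contr M x) (chiContract χ x))) f = 0 from H.1
  induction hf using Submodule.span_induction with
  | zero => simp
  | add f g _ _ hf hg => simp [hf, hg]
  | smul a f _ hf =>
    rw [smul_eq_mul, Derivation.leibniz, smul_alg_eq, smul_alg_eq, map_mul, hf.1, hf.2]
    simp
  | mem f hf =>
    obtain ((⟨i, rfl⟩ | ⟨i, hi, rfl⟩) | ⟨i, hi, rfl⟩) | ⟨C, hC, hcard, rfl⟩ := hf
    · refine ⟨?_, by rw [map_pow]; exact mk_X_sq i⟩
      rw [pow_two, Derivation.leibniz]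
      by_cases hi : InClass M x i
      · rw [smul_alg_eq, mk_X_eq_zero_of_inClass h hx hi]; simp
      · rw [classDerivation_X_of_not hi]; simp
    · refine ⟨classDerivation_X_of_not fun hix => hi (hix.isNonloop hx).mem_ground, ?_⟩
      exact mk_relation (Or.inl (Or.inl (Or.inr ⟨i, fun hi' => hi hi'.1, rfl⟩)))
    · refine ⟨classDerivation_X_of_not fun hix => hi.not_isNonloop (hix.isNonloop hx), ?_⟩
      have := cls_eq_zero (h.contract hx) (J := {i}) (fun hI => hi.not_isNonloop (by
        simpa using Matroid.Indep.of_contract hI))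
      simpa [cls, monom] using this
    · exact ⟨classDerivation_boundary h hx hC hcard, mk_contr_boundary h hx hC hcard⟩

/-- The linear map induced on the algebra by the weighted derivative along the class of `x`. -/
def classResidue (h : IsVolume M χ) (hx : M.IsNonloop x) :
    Alg M χ →ₗ[K] Alg (contr M x) (chiContract χ x) :=
  ((Ideal.span (relations M χ)).restrictScalars K).liftQ
    (classDerivation M χ x : MvPolynomial (Fin n) K →ₗ[K] Alg (contr M x) (chiContract χ x))
    fun _ hf => classDerivation_ideal h hx hf

theorem classResidue_cls (h : IsVolume M χ) (hx : M.IsNonloop x) (I : Finset (Fin n)) :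
    classResidue h hx (cls M χ I) = classDerivation M χ x (monom K I) := rfl

theorem isResidue_classResidue (h : IsVolume M χ) (hx : M.IsNonloop x) :
    IsResidue M χ x (classResidue h hx) where
  of_mem I hI hxI := by
    have hne : χ [x] ≠ 0 := h.ne_zero _ ⟨by simp, by simpa using hx⟩
    rw [classResidue_cls, classDerivation_monom hxI (Or.inl rfl), div_self hne, one_smul]
    exact fun z hz hzx => unique_inClass_of_indep hx hI hxI hz (Or.inl rfl) hzx
  of_parallel I hI y hyI hxy := by
    have hm : IndepList M ((I.erase y).sort ++ [y]) := by
      have := indepList_sort.2 hI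
      refine this.perm ?_
      rw [List.perm_ext_iff_of_nodup this.1]
      · intro a; simp; grind
      · rw [List.nodup_append_comm]; simp
    rw [classResidue_cls, classDerivation_monom hyI (Or.inr hxy), h.parallel_ratio hx (Or.inr hxy) _ hm,
      mul_div_cancel_right₀ _ (h.ne_zero _ hm)]
    exact fun z hz hzx => unique_inClass_of_indep hx hI hyI hz (Or.inr hxy) hzx
  otherwise I hI hxI hI' := by
    rw [classResidue_cls, classDerivation_monom_of_not]
    rintro y hy (rfl | hxy)
    · exact hxI hy
    · exact hI' y hy hxy

/-- Excludes the default value `0` in the choice of `residue`; from here on only the defining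
property is used. -/
theorem isResidue_residue (h : IsVolume M χ) (hx : M.IsNonloop x) :
    IsResidue M χ x (residue M χ x) := by
  have hex : ∃ f, IsResidue M χ x f := ⟨_, isResidue_classResidue h hx⟩
  rw [residue, dif_pos hex]
  exact hex.choose_spec

end Residue

/-! ### Iterated residues -/

section Iterated

variable {K : Type*} [Field K] {n : ℕ}

theorem degZero_cls (M : Matroid (Fin n)) (χ : List (Fin n) → K) (J : Finset (Fin n)) :
    degZero M χ (cls M χ J) = if J = ∅ then 1 else 0 := by
  have : degZero M χ (cls M χ J) = MvPolynomial.aeval (R := K) (fun _ => (0 : K)) (monom K J) := rfl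
  rw [this, monom, map_prod]
  split_ifs with h
  · simp [h]
  · obtain ⟨i, hi⟩ := Finset.nonempty_iff_ne_empty.2 h
    exact Finset.prod_eq_zero hi (by simp)

theorem iterResidueRev_self (l : List (Fin n)) {M : Matroid (Fin n)} {χ : List (Fin n) → K}
    (h : IsVolume M χ) (hl : IndepList M l) :
    iterResidueRev l M χ (cls M χ l.toFinset) = 1 := by
  induction l generalizing M χ with
  | nil => simp [iterResidueRev, degZero_cls]
  | cons x l ih =>
    have hx := hl.isNonloop_head
    have hxl : x ∉ l := (List.nodup_cons.1 hl.1).1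
    have hI : M.Indep ((x :: l).toFinset : Set (Fin n)) := by
      rw [List.coe_toFinset]; exact hl.2
    rw [iterResidueRev, LinearMap.comp_apply, (isResidue_residue h hx).of_mem _ hI (by simp)]
    have : (x :: l).toFinset.erase x = l.toFinset := by
      rw [List.toFinset_cons, Finset.erase_insert (by simpa using hxl)]
    rw [this]
    exact ih (h.contract hx) hl.tail_contr

/-- Lifts an equality of flags from `M/x` to `M`, where `x` and `y` may be exchanged at the head
because they span the same flat. -/
theorem closure_take_cons {M : Matroid (Fin n)} {x y : Fin n} (hx : M.IsNonloop x)
    (hxy : InClass M x y) {l l' : List (Fin n)}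
    (hl : ∀ k, (contr M x).closure {i | i ∈ l'.take k} = (contr M x).closure {i | i ∈ l.take k})
    (k : ℕ) : M.closure {i | i ∈ (y :: l').take k} = M.closure {i | i ∈ (x :: l).take k} := by
  cases k with
  | zero => simp
  | succ k =>
    have hk := hl k
    have hmem (S : Set (Fin n)) : x ∈ M.closure (insert x S) :=
      M.mem_closure_of_mem' (by simp) hx.mem_ground
    rw [contr_closure, contr_closure] at hk
    rw [List.take_succ_cons, List.take_succ_cons, setOf_mem_cons, setOf_mem_cons,
      ← hxy.closure_insert]
    have := congrArg (insert x) hk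
    rwa [Set.insert_sdiff_singleton, Set.insert_sdiff_singleton, Set.insert_eq_of_mem (hmem _),
      Set.insert_eq_of_mem (hmem _)] at this

/-- The element `y` of `J` deleted by the first residue spans the same flat as `x`. It becomes the
head of the ordering, and induction in `M/x` orders `J \ y`. -/
theorem exists_ordering_of_iterResidueRev_ne_zero (l : List (Fin n)) {M : Matroid (Fin n)}
    {χ : List (Fin n) → K} (h : IsVolume M χ) (hl : IndepList M l) {J : Finset (Fin n)}
    (hJ : M.Indep (J : Set (Fin n))) (hne : iterResidueRev l M χ (cls M χ J) ≠ 0) :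
    ∃ l', IsOrdering l' J ∧ l'.length = l.length ∧
      ∀ k, M.closure {i | i ∈ l'.take k} = M.closure {i | i ∈ l.take k} := by
  induction l generalizing M χ J with
  | nil =>
    have : J = ∅ := by
      by_contra hJ0
      exact hne (by simp [iterResidueRev, degZero_cls, hJ0])
    exact ⟨[], by simp [IsOrdering, this], rfl, fun _ => rfl⟩
  | cons x l ih =>
    have hx := hl.isNonloop_head
    have hres := isResidue_residue h hx
    rw [iterResidueRev, LinearMap.comp_apply] at hne
    obtain ⟨y, hyJ, hxy, hne'⟩ : ∃ y ∈ J, InClass M x y ∧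
        iterResidueRev l (contr M x) (chiContract χ x)
          (cls (contr M x) (chiContract χ x) (J.erase y)) ≠ 0 := by
      by_cases hxJ : x ∈ J
      · rw [hres.of_mem J hJ hxJ] at hne
        exact ⟨x, hxJ, Or.inl rfl, hne⟩
      · by_cases hpar : ∃ y ∈ J, Parallel M x y
        · obtain ⟨y, hyJ, hxy⟩ := hpar
          rw [hres.of_parallel J hJ y hyJ hxy, map_smul] at hne
          exact ⟨y, hyJ, Or.inr hxy, right_ne_zero_of_smul hne⟩
        · push Not at hpar
          rw [hres.otherwise J hJ hxJ hpar, map_zero] at hne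
          exact absurd rfl hne
    obtain ⟨l', ⟨hn, hs⟩, hlen, hcl⟩ := ih (h.contract hx) hl.tail_contr
      (hxy.indep_contr_erase hx hJ hyJ) hne'
    refine ⟨y :: l', ⟨List.nodup_cons.2 ⟨?_, hn⟩, ?_⟩, by simp [hlen], closure_take_cons hx hxy hcl⟩
    · rw [← List.mem_toFinset, hs]; simp
    · rw [List.toFinset_cons, hs, Finset.insert_erase hyJ]

theorem flag_reverse_eq {M : Matroid (Fin n)} {l l' : List (Fin n)} (hlen : l'.length = l.length)
    (hcl : ∀ k, M.closure {i | i ∈ l'.take k} = M.closure {i | i ∈ l.take k}) :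
    flag M l'.reverse = flag M l.reverse := by
  have key (m : List (Fin n)) : flag M m.reverse =
      (List.range m.length).map fun k => M.closure {i | i ∈ m.take (k + 1)} := by
    rw [flag, List.length_reverse]
    refine List.map_congr_left fun k hk => ?_
    rw [List.mem_range] at hk
    have : m.length - (m.length - (k + 1)) = k + 1 := by omega
    simp [List.drop_reverse, this]
  rw [key, key, hlen]
  exact List.map_congr_left fun k _ => hcl _

theorem iterResidue_self {M : Matroid (Fin n)} {χ : List (Fin n) → K} (h : IsVolume M χ)
    {I : Finset (Fin n)} (hI : M.Indep (I : Set (Fin n))) {l : List (Fin n)}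
    (hl : IsOrdering l I) : iterResidue M χ l (cls M χ I) = 1 := by
  obtain ⟨hn, rfl⟩ := hl
  have := iterResidueRev_self l.reverse h ⟨by simpa using hn, by simpa using hI⟩
  rwa [List.toFinset_reverse] at this

theorem exists_ordering_of_iterResidue_ne_zero {M : Matroid (Fin n)} {χ : List (Fin n) → K}
    (h : IsVolume M χ) {I J : Finset (Fin n)} (hI : M.Indep (I : Set (Fin n)))
    (hJ : M.Indep (J : Set (Fin n))) {l : List (Fin n)} (hl : IsOrdering l I)
    (hne : iterResidue M χ l (cls M χ J) ≠ 0) :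
    ∃ l', IsOrdering l' J ∧ flag M l' = flag M l := by
  obtain ⟨hn, rfl⟩ := hl
  obtain ⟨l', ⟨hn', hs⟩, hlen, hcl⟩ := exists_ordering_of_iterResidueRev_ne_zero l.reverse h
    ⟨by simpa using hn, by simpa using hI⟩ hJ hne
  refine ⟨l'.reverse, ⟨by simpa using hn', by simpa using hs⟩, ?_⟩
  simpa using flag_reverse_eq hlen hcl

theorem cls_mem_piece (M : Matroid (Fin n)) (χ : List (Fin n) → K) (J : Finset (Fin n)) :
    cls M χ J ∈ piece M χ J.card := by
  refine ⟨monom K J, ?_, rfl⟩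
  have := MvPolynomial.IsHomogeneous.prod J (fun i => (MvPolynomial.X i : MvPolynomial (Fin n) K))
    (fun _ => 1) fun i _ => MvPolynomial.isHomogeneous_X K i
  simpa [monom] using this

instance finite_piece (M : Matroid (Fin n)) (χ : List (Fin n) → K) (ℓ : ℕ) :
    Module.Finite K (piece M χ ℓ) := by
  rw [Module.Finite.iff_fg]
  exact (MvPolynomial.homogeneousSubmodule_fg _ _ ℓ).map _

/-- The iterated residues of a diagonal basis are its dual basis. -/
theorem IsDiagonalBasis.expansion {M : Matroid (Fin n)} {χ : List (Fin n) → K}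
    (h : IsVolume M χ) {ℓ : ℕ} {𝓘 : Finset (Finset (Fin n))}
    {σ : Finset (Fin n) → List (Fin n)} (h𝓘 : IsDiagonalBasis M χ ℓ 𝓘 σ) {a : Alg M χ}
    (ha : a ∈ piece M χ ℓ) : a = ∑ I ∈ 𝓘, iterResidue M χ (σ I) a • cls M χ I := by
  -- A nonzero value would give `J` an ordering with the flag of `σ I`.
  have hdual : ∀ I ∈ 𝓘, ∀ J ∈ 𝓘, J ≠ I → iterResidue M χ (σ I) (cls M χ J) = 0 := by
    intro I hI J hJ hJI
    by_contra hne
    obtain ⟨l, hl, hf⟩ := exists_ordering_of_iterResidue_ne_zero h (h𝓘.indep I hI).1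
      (h𝓘.indep J hJ).1 (h𝓘.ordering I hI) hne
    exact hJI (h𝓘.flag_inj I hI J hJ l hl hf)
  have hself : ∀ I ∈ 𝓘, iterResidue M χ (σ I) (cls M χ I) = 1 := fun I hI =>
    iterResidue_self h (h𝓘.indep I hI).1 (h𝓘.ordering I hI)
  have hpair (c : Finset (Fin n) → K) : ∀ I ∈ 𝓘,
      iterResidue M χ (σ I) (∑ J ∈ 𝓘, c J • cls M χ J) = c I := by
    intro I hI
    rw [map_sum, Finset.sum_eq_single I]
    · rw [map_smul, hself I hI, smul_eq_mul, mul_one]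
    · intro J hJ hJI
      rw [map_smul, hdual I hI J hJ hJI, smul_zero]
    · exact fun h => absurd hI h
  let b : 𝓘 → piece M χ ℓ := fun I => ⟨cls M χ I, by
    have := cls_mem_piece M χ (I : Finset (Fin n))
    rwa [(h𝓘.indep I I.2).2] at this⟩
  have hli : LinearIndependent K b := by
    rw [Fintype.linearIndependent_iff]
    intro g hg I
    have h1 := congrArg (piece M χ ℓ).subtype hg
    simp only [map_sum, map_smul, map_zero] at h1
    let c : Finset (Fin n) → K := fun J => if hJ : J ∈ 𝓘 then g ⟨J, hJ⟩ else 0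
    have h2 : ∑ J ∈ 𝓘, c J • cls M χ J = 0 := by
      rw [← h1, ← Finset.sum_coe_sort]
      exact Finset.sum_congr rfl fun J _ => by simp [c, b]
    have h3 := hpair c I I.2
    rw [h2, map_zero] at h3
    simpa [c] using h3.symm
  -- Independence gives `|𝓘| ≤ dim`, and `card_ge` the reverse, so the family spans.
  have hspan := hli.span_eq_top_of_card_eq_finrank' (le_antisymm hli.fintype_card_le_finrank
    (by simpa using h𝓘.card_ge))
  obtain ⟨g, hg⟩ := (Submodule.mem_span_range_iff_exists_fun K).1
    (hspan ▸ Submodule.mem_top : (⟨a, ha⟩ : piece M χ ℓ) ∈ Submodule.span K (Set.range b))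
  have h1 := congrArg (piece M χ ℓ).subtype hg
  simp only [map_sum, map_smul] at h1
  let c : Finset (Fin n) → K := fun J => if hJ : J ∈ 𝓘 then g ⟨J, hJ⟩ else 0
  have h2 : a = ∑ J ∈ 𝓘, c J • cls M χ J := by
    rw [← Finset.sum_coe_sort]
    exact h1.symm.trans (Finset.sum_congr rfl fun J _ => by simp [c, b])
  conv_lhs => rw [h2]
  refine Finset.sum_congr rfl fun I hI => ?_
  rw [h2, hpair c I hI]

end Iterated

/-! ### The function `χ` of a vector configuration -/

section OTChi

variable {K V : Type*} [Field K] [AddCommGroup V] [Module K V] {n : ℕ} {v : Fin n → V}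

theorem vecMatroid_indep_iff {I : Set (Fin n)} :
    (vecMatroid (K := K) v).Indep I ↔ LinearIndepOn K v I := by
  rw [vecMatroid, IndepMatroid.matroid_Indep, IndepMatroid.ofFinite_indep]

theorem flatSpan_closure {I : Set (Fin n)} (hI : (vecMatroid (K := K) v).Indep I) :
    flatSpan K v ((vecMatroid (K := K) v).closure I) = Submodule.span K (v '' I) := by
  refine le_antisymm (Submodule.span_le.2 ?_) (Submodule.span_mono (Set.image_mono
    ((vecMatroid (K := K) v).subset_closure I (Set.subset_univ _))))
  rintro _ ⟨i, hi, rfl⟩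
  by_contra hns
  have h1 := (vecMatroid_indep_iff.1 hI).insert hns
  exact hns (Submodule.subset_span ⟨i, (hI.mem_closure_iff'.1 hi).2 (vecMatroid_indep_iff.2 h1), rfl⟩)

theorem IndepList.linearIndependent {l : List (Fin n)} (hl : IndepList (vecMatroid (K := K) v) l) :
    LinearIndependent K fun j : Fin l.length => v (l.get j) := by
  have h := vecMatroid_indep_iff.1 hl.2
  refine LinearIndependent.comp h (fun j : Fin l.length => ⟨l.get j, List.get_mem l j⟩) ?_
  intro i j hij
  exact (List.nodup_iff_injective_get.1 hl.1) (by simpa using hij)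

theorem IndepList.finrank_flatSpan {l : List (Fin n)}
    (hl : IndepList (vecMatroid (K := K) v) l) :
    Module.finrank K (flatSpan K v (listFlat K v l)) = l.length := by
  have h1 := finrank_span_eq_card hl.linearIndependent
  have h2 : Set.range (fun j : Fin l.length => v (l.get j)) = v '' {i | i ∈ l} := by
    ext y
    simp [List.mem_iff_get]
  rw [listFlat, flatSpan_closure hl.2, ← h2, h1, Fintype.card_fin]

theorem mem_flatSpan_of_listFlat {F : Set (Fin n)} {l : List (Fin n)} (hl : listFlat K v l = F)
    {i : Fin n} (hi : i ∈ l) : v i ∈ flatSpan K v F := by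
  subst hl
  exact Submodule.subset_span ⟨i, Matroid.mem_closure_of_mem _ hi (Set.subset_univ _), rfl⟩

/-- With the flat and its dimension as free parameters, lists spanning the same flat get
determinants in literally the same basis. -/
theorem otChi_eq_det (B : FlatBases K v) {F : Set (Fin n)}
    (hF : (vecMatroid (K := K) v).IsFlat F) {l : List (Fin n)} (hl : listFlat K v l = F) {k : ℕ}
    (hk : Module.finrank K (flatSpan K v F) = k) (hlen : l.length = k) :
    otChi v B l = ((B F hF).reindex (finCongr hk)).det fun j : Fin k =>
      ⟨v (l.get (Fin.cast hlen.symm j)), mem_flatSpan_of_listFlat hl (List.get_mem l _)⟩ := by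
  subst hl
  subst hk
  rw [otChi, dif_pos hlen]
  simp

theorem getElem_append_swap {α : Type*} (l₁ : List α) (a b : α) (l₂ : List α) (j p q : ℕ)
    (hp : p = l₁.length) (hq : q = l₁.length + 1)
    (hj : j < (l₁ ++ b :: a :: l₂).length)
    (hj' : Equiv.swap p q j < (l₁ ++ a :: b :: l₂).length) :
    (l₁ ++ b :: a :: l₂)[j] = (l₁ ++ a :: b :: l₂)[Equiv.swap p q j] := by
  subst hp hq
  rcases lt_trichotomy j l₁.length with h | rfl | h
  · have : Equiv.swap l₁.length (l₁.length + 1) j = j :=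
      Equiv.swap_apply_of_ne_of_ne (by omega) (by omega)
    simp only [this]
    rw [List.getElem_append_left h, List.getElem_append_left h]
  · simp
  · obtain ⟨t, rfl⟩ := Nat.exists_eq_add_of_lt h
    cases t with
    | zero => simp
    | succ t =>
      have : Equiv.swap l₁.length (l₁.length + 1) (l₁.length + (t + 1) + 1) =
          l₁.length + (t + 1) + 1 := Equiv.swap_apply_of_ne_of_ne (by omega) (by omega)
      simp only [this]
      rw [List.getElem_append_right (by omega), List.getElem_append_right (by omega)]
      have e : l₁.length + (t + 1) + 1 - l₁.length = t + 2 := by omega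
      simp [e]

theorem otChi_swap (B : FlatBases K v) (l₁ : List (Fin n)) (a b : Fin n) (l₂ : List (Fin n)) :
    otChi v B (l₁ ++ a :: b :: l₂) = -otChi v B (l₁ ++ b :: a :: l₂) := by
  have hset : {i | i ∈ l₁ ++ b :: a :: l₂} = {i | i ∈ l₁ ++ a :: b :: l₂} := by
    ext i; simp; tauto
  have hflat : listFlat K v (l₁ ++ b :: a :: l₂) = listFlat K v (l₁ ++ a :: b :: l₂) := by
    rw [listFlat, listFlat, hset]
  have hl : (l₁ ++ b :: a :: l₂).length = (l₁ ++ a :: b :: l₂).length := by simp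
  by_cases hlen : (l₁ ++ a :: b :: l₂).length =
      Module.finrank K (flatSpan K v (listFlat K v (l₁ ++ a :: b :: l₂)))
  · rw [otChi_eq_det B (Matroid.isFlat_closure _) rfl rfl hlen,
      otChi_eq_det B (Matroid.isFlat_closure _) hflat rfl (hl.trans hlen), eq_neg_iff_add_eq_zero,
      add_comm]
    have hp : l₁.length < Module.finrank K (flatSpan K v (listFlat K v (l₁ ++ a :: b :: l₂))) := by
      rw [← hlen]; simp
    have hq : l₁.length + 1 <
        Module.finrank K (flatSpan K v (listFlat K v (l₁ ++ a :: b :: l₂))) := by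
      rw [← hlen]; simp
    have hne : (⟨_, hp⟩ : Fin (Module.finrank K _)) ≠ ⟨_, hq⟩ := by simp
    rw [← eq_neg_iff_add_eq_zero, ← AlternatingMap.map_swap _ _ hne]
    congr 1
    funext j
    refine Subtype.ext (congrArg v ?_)
    have hval : ((Equiv.swap (⟨_, hp⟩ : Fin (Module.finrank K _)) ⟨_, hq⟩ j : Fin _) : ℕ) =
        Equiv.swap l₁.length (l₁.length + 1) (j : ℕ) := by
      rw [Equiv.swap_apply_def, Equiv.swap_apply_def]
      simp only [Fin.ext_iff]
      split_ifs <;> rfl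
    simp only [List.get_eq_getElem, Fin.val_cast, hval]
    exact getElem_append_swap l₁ a b l₂ j _ _ rfl rfl _ _
  · rw [otChi, dif_neg hlen, otChi, dif_neg (by rw [hl, hflat]; exact hlen), neg_zero]

theorem isVolume_otChi (B : FlatBases K v) : IsVolume (vecMatroid (K := K) v) (otChi v B) where
  ne_zero l hl := by
    rw [otChi_eq_det B (Matroid.isFlat_closure _) rfl hl.finrank_flatSpan rfl]
    refine ((Module.Basis.is_basis_iff_det _).1 ?_).ne_zero
    have hli : LinearIndependent K (fun j : Fin l.length =>
        (⟨v (l.get j), mem_flatSpan_of_listFlat rfl (List.get_mem l j)⟩ :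
          flatSpan K v (listFlat K v l))) :=
      LinearIndependent.of_comp (Submodule.subtype _) hl.linearIndependent
    have : FiniteDimensional K (flatSpan K v (listFlat K v l)) :=
      FiniteDimensional.span_of_finite K (Set.toFinite _)
    exact ⟨hli, hli.span_eq_top_of_card_eq_finrank'
      (by rw [hl.finrank_flatSpan, Fintype.card_fin])⟩
  swap := otChi_swap B
  cons_mul a l l' hl hl' hcl := by
    have hcl' : listFlat K v (a :: l') = listFlat K v (a :: l) := by
      rw [listFlat, listFlat, setOf_mem_cons, setOf_mem_cons]
      exact Matroid.closure_insert_congr_right hcl.symm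
    have hk := hl.of_cons.finrank_flatSpan
    have hk1 := hl.finrank_flatSpan
    have hlen : l'.length = l.length := by
      rw [← hk, ← hl'.finrank_flatSpan, listFlat, listFlat, hcl]
    rw [otChi_eq_det B (Matroid.isFlat_closure _) rfl hk1 rfl,
      otChi_eq_det B (Matroid.isFlat_closure _) hcl' hk1 (by simp [hlen]),
      otChi_eq_det B (Matroid.isFlat_closure _) rfl hk rfl,
      otChi_eq_det B (Matroid.isFlat_closure _) hcl.symm hk hlen]
    set bF := (B (listFlat K v l) (Matroid.isFlat_closure _)).reindex (finCongr hk)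
    set bG := (B (listFlat K v (a :: l)) (Matroid.isFlat_closure _)).reindex (finCongr hk1)
    have hFG : flatSpan K v (listFlat K v l) ≤ flatSpan K v (listFlat K v (a :: l)) :=
      Submodule.span_mono (Set.image_mono (Matroid.closure_subset_closure _
        (by rw [setOf_mem_cons]; exact Set.subset_insert _ _)))
    -- Inserting `a` in the larger determinant gives a top-degree alternating form on the smaller
    -- span. It is thus a multiple of the smaller determinant, with a factor not depending on `l` or
    -- `l'`.
    let f := (bG.det.curryLeft ⟨v a, mem_flatSpan_of_listFlat rfl (by simp)⟩).compLinearMap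
      (Submodule.inclusion hFG)
    have hf := f.eq_smul_basis_det bF
    have key (m : List (Fin n)) (hm : m.length = l.length) (hmF : listFlat K v m = listFlat K v l)
        (hmG : listFlat K v (a :: m) = listFlat K v (a :: l)) (hm1 : (a :: m).length = l.length + 1) :
        bG.det (fun j : Fin (l.length + 1) => ⟨v ((a :: m).get (Fin.cast hm1.symm j)),
          mem_flatSpan_of_listFlat hmG (List.get_mem _ _)⟩) =
        f bF * bF.det fun j : Fin l.length => ⟨v (m.get (Fin.cast hm.symm j)),
          mem_flatSpan_of_listFlat hmF (List.get_mem _ _)⟩ := by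
      rw [← smul_eq_mul, ← AlternatingMap.smul_apply, ← hf]
      change _ = bG.det (Matrix.vecCons _ _)
      congr 1
      funext j
      refine Fin.cases rfl (fun j => rfl) j
    have e1 := key l rfl rfl rfl rfl
    have e2 := key l' hlen hcl.symm hcl' (by simp [hlen])
    simp only [List.length_cons] at e1 e2 ⊢
    erw [e1, e2]
    ring

theorem card_filter_le_orderEmbOfFin (C : Finset (Fin n)) {m : ℕ} (h : C.card = m) (j : Fin m) :
    (C.filter (fun i => i ≤ C.orderEmbOfFin h j)).card = j + 1 := by
  have : C.filter (fun i => i ≤ C.orderEmbOfFin h j) =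
      (Finset.Iic j).map (C.orderEmbOfFin h).toEmbedding := by
    ext i
    simp only [Finset.mem_filter, Finset.mem_map, Finset.mem_Iic, RelEmbedding.coe_toEmbedding]
    constructor
    · rintro ⟨hi, hij⟩
      rw [← Finset.mem_coe, ← Finset.range_orderEmbOfFin C h] at hi
      obtain ⟨k, rfl⟩ := hi
      exact ⟨k, by simpa using hij, rfl⟩
    · rintro ⟨k, hk, rfl⟩
      exact ⟨Finset.orderEmbOfFin_mem .., by simpa using hk⟩
  rw [this, Finset.card_map, Fin.card_Iic]

theorem sort_erase_orderEmbOfFin_get (C : Finset (Fin n)) {m : ℕ} (h : C.card = m + 1)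
    (j : Fin (m + 1)) (hlen : ((C.erase (C.orderEmbOfFin h j)).sort).length = m) (r : Fin m) :
    ((C.erase (C.orderEmbOfFin h j)).sort).get (Fin.cast hlen.symm r) =
      C.orderEmbOfFin h (j.succAbove r) := by
  have hcard : (C.erase (C.orderEmbOfFin h j)).card = m := by simpa using hlen
  have := Finset.orderEmbOfFin_unique hcard (f := fun r => C.orderEmbOfFin h (j.succAbove r))
    (fun r => by simp [Fin.succAbove_ne])
    (fun r s hrs => by simpa using hrs)
  refine Eq.trans ?_ (congrFun this r).symm
  exact (Finset.orderEmbOfFin_apply (C.erase (C.orderEmbOfFin h j)) hcard r).symm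

/-- The signed volumes of a circuit in an affine hyperplane add up to zero. -/
theorem sum_otChi_circuit (B : FlatBases K v) (φ : V →ₗ[K] K) (hφ : ∀ i, φ (v i) = 1)
    {C : Finset (Fin n)} (hC : (vecMatroid (K := K) v).IsCircuit (C : Set (Fin n))) :
    ∑ i ∈ C, (-1 : K) ^ (C.filter (fun j => j ≤ i)).card * otChi v B (C.erase i).sort = 0 := by
  obtain ⟨m, hm⟩ : ∃ m, C.card = m + 1 :=
    Nat.exists_eq_succ_of_ne_zero (Finset.card_ne_zero.2 hC.nonempty)
  set F := (vecMatroid (K := K) v).closure (C : Set (Fin n)) with hF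
  have hflat : ∀ i ∈ C, listFlat K v (C.erase i).sort = F := fun i hi => by
    rw [listFlat, setOf_mem_sort, closure_erase hC]
  have hlen : ∀ i ∈ C, ((C.erase i).sort).length = m := fun i hi => by
    rw [Finset.length_sort, Finset.card_erase_of_mem hi, hm, Nat.add_sub_cancel]
  have hk : Module.finrank K (flatSpan K v F) = m := by
    obtain ⟨i, hi⟩ := hC.nonempty
    rw [← hflat i hi, ← hlen i hi]
    exact (indepList_sort.2 (indep_erase hC hi)).finrank_flatSpan
  let b := (B F (Matroid.isFlat_closure _)).reindex (finCongr hk)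
  let e := C.orderEmbOfFin hm
  have he : ∀ j, e j ∈ C := fun j => Finset.orderEmbOfFin_mem ..
  let w : Fin (m + 1) → flatSpan K v F := fun j => ⟨v (e j), Submodule.subset_span
    ⟨_, Matroid.mem_closure_of_mem _ (he j) (Set.subset_univ _), rfl⟩⟩
  -- A row of ones above the coordinates of the circuit's vectors; expanding along it produces the
  -- signed sum of the volumes.
  let A : Matrix (Fin (m + 1)) (Fin (m + 1)) K :=
    Matrix.of (Matrix.vecCons (fun _ => 1) fun r j => b.repr (w j) r)
  have hdet : A.det = 0 := by
    rw [← Matrix.exists_vecMul_eq_zero_iff]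
    -- The rows are dependent: since `φ` is 1 on each vector, the row of ones is the combination of
    -- the coordinate rows with coefficients `φ (b r)`.
    refine ⟨Matrix.vecCons 1 fun r => -φ (b r), fun h => by simpa using congrFun h 0, ?_⟩
    funext j
    have h1 := congrArg (φ ∘ₗ (flatSpan K v F).subtype) (b.sum_repr (w j))
    simp only [map_sum, map_smul] at h1
    have h2 : (φ ∘ₗ (flatSpan K v F).subtype) (w j) = 1 := hφ _
    rw [h2] at h1
    rw [Matrix.vecMul, dotProduct, Fin.sum_univ_succ]
    simp only [Matrix.cons_val_zero, Matrix.cons_val_succ, A, Matrix.of_apply, neg_mul,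
      Finset.sum_neg_distrib, Pi.zero_apply, mul_one]
    rw [← h1]
    simp [mul_comm]
  rw [Matrix.det_succ_row_zero] at hdet
  have hsum : ∑ i ∈ C, (-1 : K) ^ (C.filter (fun j => j ≤ i)).card * otChi v B (C.erase i).sort =
      ∑ j, (-1 : K) ^ (C.filter (fun i => i ≤ e j)).card * otChi v B (C.erase (e j)).sort := by
    conv_lhs => enter [1]; rw [← Finset.map_orderEmbOfFin_univ C hm]
    rw [Finset.sum_map]
    rfl
  rw [hsum]
  -- Positions in the boundary start at 1 and those in the Laplace expansion at 0, whence the global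
  -- minus sign.
  have : ∑ j, (-1 : K) ^ (C.filter (fun i => i ≤ e j)).card * otChi v B (C.erase (e j)).sort =
      -∑ j : Fin (m + 1), (-1) ^ (j : ℕ) * A 0 j * (A.submatrix Fin.succ j.succAbove).det := by
    rw [← Finset.sum_neg_distrib]
    refine Finset.sum_congr rfl fun j _ => ?_
    rw [card_filter_le_orderEmbOfFin C hm j, pow_succ,
      otChi_eq_det B (Matroid.isFlat_closure _) (hflat _ (he j)) hk (hlen _ (he j))]
    have hA : A 0 j = 1 := rfl
    have hsub : (A.submatrix Fin.succ j.succAbove).det = b.det fun r => w (j.succAbove r) := rfl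
    rw [hA, hsub]
    have : (fun r : Fin m => (⟨v ((C.erase (e j)).sort.get (Fin.cast (hlen _ (he j)).symm r)),
        mem_flatSpan_of_listFlat (hflat _ (he j)) (List.get_mem _ _)⟩ : flatSpan K v F)) =
        fun r => w (j.succAbove r) := by
      funext r
      exact Subtype.ext (congrArg v (sort_erase_orderEmbOfFin_get C hm j (hlen _ (he j)) r))
    rw [this]
    ring
  rw [this, hdet, neg_zero]

end OTChi

/-! ### The linear form taking the value one at independent monomials -/

section SupportForm

variable {K : Type*} [Field K] {n : ℕ} {M : Matroid (Fin n)}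

/-- The exponent of a squarefree monomial with independent support. -/
def IndepExponent (M : Matroid (Fin n)) (m : Fin n →₀ ℕ) : Prop :=
  (∀ i, m i ≤ 1) ∧ M.Indep (m.support : Set (Fin n))

open Classical in
/-- The linear form with value `1` at the squarefree monomials with independent support, and `0` at
all the other monomials. -/
def supportForm (K : Type*) [Field K] {n : ℕ} (M : Matroid (Fin n)) :
    MvPolynomial (Fin n) K →ₗ[K] K :=
  (MvPolynomial.basisMonomials (Fin n) K).constr K fun m => if IndepExponent M m then 1 else 0

open Classical in
theorem supportForm_monomial (m : Fin n →₀ ℕ) :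
    supportForm K M (MvPolynomial.monomial m 1) = if IndepExponent M m then 1 else 0 := by
  have := (MvPolynomial.basisMonomials (Fin n) K).constr_basis K
    (fun m => if IndepExponent M m then (1 : K) else 0) m
  rwa [MvPolynomial.coe_basisMonomials] at this

/-- The exponent of the monomial `e_X`. -/
def exponent (X : Finset (Fin n)) : Fin n →₀ ℕ := ∑ i ∈ X, Finsupp.single i 1

theorem exponent_apply (X : Finset (Fin n)) (i : Fin n) :
    exponent X i = if i ∈ X then 1 else 0 := by
  simp [exponent, Finsupp.finsetSum_apply, Finsupp.single_apply]

theorem monom_eq_monomial (X : Finset (Fin n)) :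
    monom K X = MvPolynomial.monomial (exponent X) 1 := by
  rw [exponent, MvPolynomial.monomial_sum_one]; rfl

theorem indepExponent_add_exponent {m : Fin n →₀ ℕ} {X : Finset (Fin n)} :
    IndepExponent M (m + exponent X) ↔
      (∀ i, m i ≤ 1) ∧ Disjoint m.support X ∧
        M.Indep ((m.support ∪ X : Finset (Fin n)) : Set (Fin n)) := by
  have hs : (m + exponent X).support = m.support ∪ X := by
    ext i; simp [exponent_apply]; tauto
  rw [IndepExponent, hs, ← and_assoc]
  refine and_congr_left fun _ => ?_
  rw [Finset.disjoint_left, ← forall_and]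
  refine forall_congr' fun i => ?_
  simp only [Finsupp.coe_add, Pi.add_apply, exponent_apply, Finsupp.mem_support_iff]
  split_ifs with hi <;> simp [hi]
  grind

/-- Circuit exchange. Let `S` be the support of `m` together with `C \ {i, j}`, so that `S ∪ {j}` is
independent. If `i` were in the closure of `S`, then so would be all of `C \ j`, hence `j` as well.
-/
theorem indepExponent_add_erase_of {C : Finset (Fin n)} (hC : M.IsCircuit (C : Set (Fin n)))
    {m : Fin n →₀ ℕ} {i j : Fin n} (hi : i ∈ C) (hj : j ∈ C)
    (h : IndepExponent M (m + exponent (C.erase i))) :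
    IndepExponent M (m + exponent (C.erase j)) := by
  obtain rfl | hij := eq_or_ne i j
  · exact h
  rw [indepExponent_add_exponent] at h ⊢
  obtain ⟨h1, h2, h3⟩ := h
  have him : i ∉ m.support := fun him => hC.not_indep (h3.subset (by
    intro k hk; simp at hk him ⊢; grind))
  refine ⟨h1, ?_, ?_⟩
  · rw [Finset.disjoint_left] at h2 ⊢
    grind
  · set S : Set (Fin n) := ((m.support ∪ (C.erase i).erase j : Finset (Fin n)) : Set (Fin n)) with hS
    have hjm : j ∉ m.support := by
      rw [Finset.disjoint_left] at h2
      intro hjm; exact h2 hjm (by simp [hj, hij.symm])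
    have hiS : i ∉ S := by rw [hS, Finset.mem_coe]; grind
    have hjS : j ∉ S := by rw [hS, Finset.mem_coe]; grind
    have e1 : ((m.support ∪ C.erase i : Finset (Fin n)) : Set (Fin n)) = insert j S := by
      rw [hS, ← Finset.coe_insert]; congr 1; ext k; simp; grind
    have e2 : ((m.support ∪ C.erase j : Finset (Fin n)) : Set (Fin n)) = insert i S := by
      rw [hS, ← Finset.coe_insert]; congr 1; ext k; simp; grind
    rw [e1] at h3
    rw [e2]
    have hSI := h3.subset (Set.subset_insert _ _)
    rw [hSI.insert_indep_iff_of_notMem hjS] at h3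
    rw [hSI.insert_indep_iff_of_notMem hiS]
    refine ⟨hC.subset_ground hi, fun hiS' => h3.2 ?_⟩
    have hsub : ((C.erase j : Finset (Fin n)) : Set (Fin n)) ⊆ M.closure S := by
      intro k hk
      by_cases hki : k = i
      · rw [hki]; exact hiS'
      · refine M.mem_closure_of_mem ?_ hSI.subset_ground
        rw [hS, Finset.mem_coe]; rw [Finset.mem_coe] at hk; grind
    have := M.closure_subset_closure_of_subset_closure hsub
    rw [closure_erase hC] at this
    exact this (M.mem_closure_of_mem hj hC.subset_ground)

/-- On `m ∂e_C` the form has the same value at every `m e_{C \ i}`; this value factors out and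
leaves the signed sum of `hχ`. The other relations yield only monomials of value 0. -/
theorem supportForm_mul_relation {χ : List (Fin n) → K}
    (hχ : ∀ C : Finset (Fin n), M.IsCircuit (C : Set (Fin n)) → 1 < C.card →
      ∑ i ∈ C, (-1 : K) ^ (C.filter (fun j => j ≤ i)).card * χ (C.erase i).sort = 0)
    (a : MvPolynomial (Fin n) K) {f : MvPolynomial (Fin n) K} (hf : f ∈ relations M χ) :
    supportForm K M (a * f) = 0 := by
  classical
  suffices H : supportForm K M ∘ₗ LinearMap.mulRight K f = 0 from LinearMap.congr_fun H a
  refine (MvPolynomial.basisMonomials (Fin n) K).ext fun m => ?_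
  rw [MvPolynomial.coe_basisMonomials, LinearMap.comp_apply, LinearMap.mulRight_apply,
    LinearMap.zero_apply]
  have hvar {i : Fin n} (hi : ¬ M.Indep {i}) :
      supportForm K M (MvPolynomial.monomial m 1 * MvPolynomial.X i) = 0 := by
    rw [MvPolynomial.X, MvPolynomial.monomial_mul, mul_one, supportForm_monomial, if_neg]
    intro h
    exact hi (h.2.subset (by simp))
  obtain ((⟨i, rfl⟩ | ⟨i, hi, rfl⟩) | ⟨i, hi, rfl⟩) | ⟨C, hC, hcard, rfl⟩ := hf
  · rw [MvPolynomial.X_pow_eq_monomial, MvPolynomial.monomial_mul, mul_one, supportForm_monomial,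
      if_neg]
    intro h
    have := h.1 i
    simp at this
  · exact hvar fun h => hi (h.subset_ground rfl)
  · exact hvar fun h => hi.not_isNonloop (Matroid.indep_singleton.1 h)
  · obtain ⟨k, hk⟩ := hC.nonempty
    rw [boundary, Finset.mul_sum, map_sum]
    have : ∀ i ∈ C, supportForm K M (MvPolynomial.monomial m 1 *
        (((-1 : K) ^ (C.filter (fun j => j ≤ i)).card * χ (C.erase i).sort) •
          monom K (C.erase i))) =
        ((-1 : K) ^ (C.filter (fun j => j ≤ i)).card * χ (C.erase i).sort) *
          if IndepExponent M (m + exponent (C.erase k)) then 1 else 0 := by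
      intro i hi
      rw [mul_smul_comm, map_smul, monom_eq_monomial, MvPolynomial.monomial_mul, mul_one,
        supportForm_monomial, smul_eq_mul]
      congr 1
      exact if_congr ⟨indepExponent_add_erase_of hC hi hk, indepExponent_add_erase_of hC hk hi⟩
        rfl rfl
    rw [Finset.sum_congr rfl this, ← Finset.sum_mul, hχ C hC hcard, zero_mul]

/-- If the signed volumes of each circuit add up to zero, then some linear form on the algebra has
the value `1` at the class of each independent set. -/
theorem exists_linearForm {χ : List (Fin n) → K}
    (hχ : ∀ C : Finset (Fin n), M.IsCircuit (C : Set (Fin n)) → 1 < C.card →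
      ∑ i ∈ C, (-1 : K) ^ (C.filter (fun j => j ≤ i)).card * χ (C.erase i).sort = 0) :
    ∃ ε : Alg M χ →ₗ[K] K, ∀ J : Finset (Fin n), M.Indep (J : Set (Fin n)) →
      ε (cls M χ J) = 1 := by
  classical
  have hker : ∀ f ∈ Ideal.span (relations M χ), supportForm K M f = 0 := by
    intro f hf
    -- The form is not multiplicative, so the induction over the ideal needs all multiples of `f`.
    suffices H : ∀ a, supportForm K M (a * f) = 0 by simpa using H 1
    induction hf using Submodule.span_induction with
    | zero => simp
    | add f g _ _ hf hg => intro a; rw [mul_add, map_add, hf, hg, add_zero]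
    | smul b f _ hf => intro a; rw [smul_eq_mul, ← mul_assoc]; exact hf _
    | mem f hf => exact fun a => supportForm_mul_relation hχ a hf
  refine ⟨((Ideal.span (relations M χ)).restrictScalars K).liftQ (supportForm K M)
    fun f hf => hker f hf, fun J hJ => ?_⟩
  change supportForm K M (monom K J) = 1
  have := indepExponent_add_exponent (M := M) (m := 0) (X := J)
  rw [monom_eq_monomial, supportForm_monomial, if_pos]
  rw [zero_add] at this
  exact this.2 ⟨by simp, by simp, by simpa using hJ⟩

end SupportForm

end

end OSTerao

/-! ### Evaluating the expansion of `e_J` -/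

theorem mainTheorem8 {K : Type*} [Field K] {d n : ℕ}
    (v : Fin n → (Fin (d + 1) → K)) (hv : ∀ i, v i (Fin.last d) = 1)
    (B : OSTerao.FlatBases K v) (ℓ : ℕ)
    (𝓘 : Finset (Finset (Fin n))) (σ : Finset (Fin n) → List (Fin n))
    (h𝓘 : OSTerao.IsDiagonalBasis (OSTerao.vecMatroid (K := K) v) (OSTerao.otChi v B) ℓ 𝓘 σ)
    (J : Finset (Fin n)) (hJ : J.card = ℓ)
    (hJ0 : OSTerao.cls (OSTerao.vecMatroid (K := K) v) (OSTerao.otChi v B) J ≠ 0) :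
    ∑ I ∈ 𝓘, OSTerao.iterResidue (OSTerao.vecMatroid (K := K) v) (OSTerao.otChi v B) (σ I)
      (OSTerao.cls (OSTerao.vecMatroid (K := K) v) (OSTerao.otChi v B) J) = 1 := by
  have hvol := OSTerao.isVolume_otChi B
  have hJI : (OSTerao.vecMatroid (K := K) v).Indep (J : Set (Fin n)) := by
    by_contra hJI
    exact hJ0 (OSTerao.cls_eq_zero hvol hJI)
  obtain ⟨ε, hε⟩ := OSTerao.exists_linearForm (M := OSTerao.vecMatroid (K := K) v)
    (χ := OSTerao.otChi v B)
    fun C hC _ => OSTerao.sum_otChi_circuit B (LinearMap.proj (Fin.last d)) hv hC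
  have hmem := OSTerao.cls_mem_piece (OSTerao.vecMatroid (K := K) v) (OSTerao.otChi v B) J
  rw [hJ] at hmem
  -- All basis monomials and `e_J` have independent support, so `ε` replaces each of them by 1.
  have h := congrArg ε (h𝓘.expansion hvol hmem)
  rw [hε J hJI, map_sum] at h
  rw [h]
  refine Finset.sum_congr rfl fun I hI => ?_
  rw [map_smul, hε I (h𝓘.indep I hI).1, smul_eq_mul, mul_one]
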